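/- Let $q\ge 0$, let $a<b$ be real numbers, let $m\ge 0$, and let $s_0,\dots,s_m$ be complex $q\times q$ matrices. Put $\widehat s_j:=-ab\,s_j+(a+b)s_{j+1}-s_{j+2}$ and, for the block matrices with $l,k=0,\dots,j$, $$H_{1,j}:=(s_{l+k}),\quad H_{2,j}:=(\widehat s_{l+k}),\quad K_{1,j}:=(b\,s_{l+k}-s_{l+k+1}),\quad K_{2,j}:=(-a\,s_{l+k}+s_{l+k+1}).$$ Assume that $(s_k)_{k=0}^m$ is a Hausdorff positive definite sequence on $[a,b]$, that is: if $m=2n$, then $H_{1,n}$ and (when $n\ge1$) $H_{2,n-1}$ are positive definite; if $m=2n+1$, then $K_{1,n}$ and $K_{2,n}$ are positive definite. For $j\ge1$ let $Y_{1,j}$, $Y_{2,j}$, $\widetilde Y_{1,j}$, $\widetilde Y_{2,j}$ be the block columns with the $j$ blocks $s_i$, $\widehat s_i$, $b s_i-s_{i+1}$, $-a s_i+s_{i+1}$ $(i=j,\dots,2j-1)$, respectively. The Schur complements are $$\widehat H_{1,0}=s_0,\quad \widehat H_{2,0}=\widehat s_0,\quad \widehat K_{1,0}=b s_0-s_1,\quad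 \widehat K_{2,0}=-as_0+s_1,$$ and, for $j\ge1$, $$\widehat H_{1,j}=s_{2j}-Y_{1,j}^*H_{1,j-1}^{-1}Y_{1,j},\qquad \widehat H_{2,j}=\widehat s_{2j}-Y_{2,j}^*H_{2,j-1}^{-1}Y_{2,j},$$ $$\widehat K_{1,j}=b s_{2j}-s_{2j+1}-\widetilde Y_{1,j}^*K_{1,j-1}^{-1}\widetilde Y_{1,j},\qquad \widehat K_{2,j}=-a s_{2j}+s_{2j+1}-\widetilde Y_{2,j}^*K_{2,j-1}^{-1}\widetilde Y_{2,j}.$$ Let $T_j$ be the $(j+1)\times(j+1)$ block matrix with $I_q$ on the first block subdiagonal and $0$ elsewhere, $R_j(z)=(I-zT_j)^{-1}$, and let $v_j$, $u_{2,j}$, $\widetilde u_{2,j}$ be the block columns $$v_j=(I_q,0,\dots,0),\quad u_{2,j}=(-(a+b)s_0+s_1,-\widehat s_0,\dots,-\widehat s_{j-1}),\quad \widetilde u_{2,j}=(-s_0,-s_1+as_0,\dots,-s_j+as_{j-1}).$$ Put $P_{1,0}=\Gamma_{1,0}=I_q$, $Q_{2,0}(z)=-(u_{2,0}+zs_0)$,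 $\Theta_{2,0}=-s_0$ and, for $j\ge1$, $$P_{1,j}(z)=(-Y_{1,j}^*H_{1,j-1}^{-1},I_q)R_j(z)v_j,\qquad \Gamma_{1,j}(z)=(-\widetilde Y_{1,j}^*K_{1,j-1}^{-1},I_q)R_j(z)v_j,$$ $$Q_{2,j}(z)=-(-Y_{2,j}^*H_{2,j-1}^{-1},I_q)R_j(z)(u_{2,j}+zv_js_0),\qquad \Theta_{2,j}(z)=(-\widetilde Y_{2,j}^*K_{2,j-1}^{-1},I_q)R_j(z)\widetilde u_{2,j}.$$ With $$t_j=v_j^*R_j(a)^*K_{1,j}^{-1}R_j(a)v_j,\qquad g_j=(u_{2,j}^*+as_0v_j^*)R_j(a)^*H_{2,j}^{-1}R_j(a)(u_{2,j}+av_js_0),$$ the Dyukarev–Stieltjes matrix (DSM) parameters are $\mathbf m_0=t_0$, $\mathbf l_0=g_0$, and $\mathbf m_j=t_j-t_{j-1}$, $\mathbf l_j=g_j-g_{j-1}$ for $j\ge1$. Write $\overrightarrow{\prod}_{k=0}^{N}A_k=A_0A_1\cdots A_N$, $\overleftarrow{\prod}_{k=0}^{N}A_k=A_N\cdots A_1A_0$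 (both are $I_q$ for $N=-1$), and $X^{-1*}=(X^{-1})^*$. Then $H_{1,j},\widehat H_{1,j}$ ($2j\le m$), $K_{1,j},K_{2,j},\widehat K_{1,j},\widehat K_{2,j},\mathbf m_j$ ($2j+1\le m$) and $H_{2,j},\widehat H_{2,j},\mathbf l_j$ ($2j+2\le m$) are positive definite, so that all the inverses above and below exist, and the following hold. 1. The Schur complements in terms of the DSM parameters: $$\widehat H_{2,j}=\overrightarrow{\prod_{k=0}^{j}}(\mathbf m_k\mathbf l_k)^{-1*}\;\mathbf l_j\;\overleftarrow{\prod_{k=0}^{j}}(\mathbf m_k\mathbf l_k)^{-1}\quad(2j+2\le m),$$ $$\widehat K_{1,j}=\overrightarrow{\prod_{k=0}^{j-1}}(\mathbf m_k\mathbf l_k)^{-1*}\;\mathbf m_j^{-1}\;\overleftarrow{\prod_{k=0}^{j-1}}(\mathbf m_k\mathbf l_k)^{-1}\quad(2j+1\le m);$$ in particular $\widehat H_{2,0}=(\mathbf m_0\mathbf l_0)^{-1*}\mathbf l_0(\mathbf m_0\mathbf l_0)^{-1}$ and $\widehat K_{1,0}=\mathbf m_0^{-1}$. 2. The values at $a$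 as alternating products of Schur complements: $$P_{1,j}(a)=(-1)^j\overleftarrow{\prod_{k=0}^{j-1}}\widehat K_{2,k}\widehat H_{1,k}^{-1}\quad(2j\le m+1),\qquad \Gamma_{1,j}(a)=(-1)^j\overleftarrow{\prod_{k=0}^{j-1}}\widehat H_{2,k}\widehat K_{1,k}^{-1}\quad(2j\le m),$$ $$Q_{2,j}(a)=(-1)^j\widehat K_{1,j}\overleftarrow{\prod_{k=0}^{j-1}}\widehat H_{2,k}^{-1}\widehat K_{1,k}\quad(2j+1\le m),\qquad \Theta_{2,j}(a)=(-1)^{j+1}\widehat H_{1,j}\overleftarrow{\prod_{k=0}^{j-1}}\widehat K_{2,k}^{-1}\widehat H_{1,k}\quad(2j\le m).$$ 3. The DSM parameters in terms of the Schur complements: $$\mathbf m_j=\overrightarrow{\prod_{k=0}^{j-1}}(\widehat H_{2,k}\widehat K_{1,k}^{-1})^*\;\widehat K_{1,j}^{-1}\;\overleftarrow{\prod_{k=0}^{j-1}}\widehat H_{2,k}\widehat K_{1,k}^{-1}\quad(2j+1\le m),$$ $$\mathbf l_j=\overrightarrow{\prod_{k=0}^{j}}(\widehat H_{2,k}^{-1}\widehat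 K_{1,k})^*\;\widehat H_{2,j}\;\overleftarrow{\prod_{k=0}^{j}}\widehat H_{2,k}^{-1}\widehat K_{1,k}\quad(2j+2\le m);$$ in particular $\mathbf m_0=\widehat K_{1,0}^{-1}$ and $\mathbf l_0=(\widehat H_{2,0}^{-1}\widehat K_{1,0})^*\widehat H_{2,0}(\widehat H_{2,0}^{-1}\widehat K_{1,0})$. -/

import Mathlib

open scoped ComplexOrder Matrix

namespace THMM

noncomputable section

/-- The block Hankel matrix with blocks `f (l + k)`, `0 ≤ l, k ≤ j`. -/
def hankel {q : ℕ} (f : ℕ → Matrix (Fin q) (Fin q) ℂ) (j : ℕ) :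
    Matrix (Fin (j + 1) × Fin q) (Fin (j + 1) × Fin q) ℂ :=
  Matrix.of fun x y => f ((x.1 : ℕ) + (y.1 : ℕ)) x.2 y.2

/-- The block column with the `N` blocks `f 0, …, f (N - 1)`. -/
def blockCol {q : ℕ} (f : ℕ → Matrix (Fin q) (Fin q) ℂ) (N : ℕ) :
    Matrix (Fin N × Fin q) (Fin q) ℂ :=
  Matrix.of fun x c => f (x.1 : ℕ) x.2 c

/-- The block row `(A, I_q)`. -/
def rowI {q j : ℕ} (A : Matrix (Fin q) (Fin j × Fin q) ℂ) :
    Matrix (Fin q) (Fin (j + 1) × Fin q) ℂ :=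
  Matrix.of fun r x =>
    if h : (x.1 : ℕ) < j then A r (⟨x.1, h⟩, x.2) else (1 : Matrix (Fin q) (Fin q) ℂ) r x.2

/-- `ŝ_j = -ab s_j + (a+b) s_{j+1} - s_{j+2}`. -/
def sHat {q : ℕ} (a b : ℝ) (s : ℕ → Matrix (Fin q) (Fin q) ℂ) (j : ℕ) :
    Matrix (Fin q) (Fin q) ℂ :=
  -((a : ℂ) * (b : ℂ)) • s j + ((a : ℂ) + (b : ℂ)) • s (j + 1) - s (j + 2)

/-- `b s_j - s_{j+1}`. -/
def sB {q : ℕ} (b : ℝ) (s : ℕ → Matrix (Fin q) (Fin q) ℂ) (j : ℕ) :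
    Matrix (Fin q) (Fin q) ℂ :=
  (b : ℂ) • s j - s (j + 1)

/-- `-a s_j + s_{j+1}`. -/
def sA {q : ℕ} (a : ℝ) (s : ℕ → Matrix (Fin q) (Fin q) ℂ) (j : ℕ) :
    Matrix (Fin q) (Fin q) ℂ :=
  -(a : ℂ) • s j + s (j + 1)

/-- `H_{1,j}`. -/
def H1 {q : ℕ} (s : ℕ → Matrix (Fin q) (Fin q) ℂ) (j : ℕ) :
    Matrix (Fin (j + 1) × Fin q) (Fin (j + 1) × Fin q) ℂ :=
  hankel s j

/-- `H_{2,j}`. -/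
def H2 {q : ℕ} (a b : ℝ) (s : ℕ → Matrix (Fin q) (Fin q) ℂ) (j : ℕ) :
    Matrix (Fin (j + 1) × Fin q) (Fin (j + 1) × Fin q) ℂ :=
  hankel (sHat a b s) j

/-- `K_{1,j}`. -/
def K1 {q : ℕ} (b : ℝ) (s : ℕ → Matrix (Fin q) (Fin q) ℂ) (j : ℕ) :
    Matrix (Fin (j + 1) × Fin q) (Fin (j + 1) × Fin q) ℂ :=
  hankel (sB b s) j

/-- `K_{2,j}`. -/
def K2 {q : ℕ} (a : ℝ) (s : ℕ → Matrix (Fin q) (Fin q) ℂ) (j : ℕ) :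
    Matrix (Fin (j + 1) × Fin q) (Fin (j + 1) × Fin q) ℂ :=
  hankel (sA a s) j

/-- `(s_k)_{k=0}^m` is a Hausdorff positive definite sequence on `[a,b]`: for `m = 2j` the matrices
`H_{1,j}` and (if `j ≥ 1`) `H_{2,j-1}` are positive definite, for `m = 2j+1` the matrices
`K_{1,j}` and `K_{2,j}` are. Only `s 0, …, s m` enter. -/
def HausdorffPosDef {q : ℕ} (a b : ℝ) (s : ℕ → Matrix (Fin q) (Fin q) ℂ) (m : ℕ) : Prop :=
  (∀ j : ℕ, m = 2 * j → (H1 s j).PosDef ∧ ∀ i : ℕ, j = i + 1 → (H2 a b s i).PosDef) ∧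
  (∀ j : ℕ, m = 2 * j + 1 → (K1 b s j).PosDef ∧ (K2 a s j).PosDef)

/-- `Y_{1,j}`, the column of `s_j, …, s_{2j-1}`. -/
def Y1 {q : ℕ} (s : ℕ → Matrix (Fin q) (Fin q) ℂ) (j : ℕ) : Matrix (Fin j × Fin q) (Fin q) ℂ :=
  blockCol (fun i => s (j + i)) j

/-- `Y_{2,j}`, the column of `ŝ_j, …, ŝ_{2j-1}`. -/
def Y2 {q : ℕ} (a b : ℝ) (s : ℕ → Matrix (Fin q) (Fin q) ℂ) (j : ℕ) :
    Matrix (Fin j × Fin q) (Fin q) ℂ :=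
  blockCol (fun i => sHat a b s (j + i)) j

/-- `Ỹ_{1,j} = b y_{[j,2j-1]} - y_{[j+1,2j]}`. -/
def Yt1 {q : ℕ} (b : ℝ) (s : ℕ → Matrix (Fin q) (Fin q) ℂ) (j : ℕ) :
    Matrix (Fin j × Fin q) (Fin q) ℂ :=
  blockCol (fun i => sB b s (j + i)) j

/-- `Ỹ_{2,j} = -a y_{[j,2j-1]} + y_{[j+1,2j]}`. -/
def Yt2 {q : ℕ} (a : ℝ) (s : ℕ → Matrix (Fin q) (Fin q) ℂ) (j : ℕ) :
    Matrix (Fin j × Fin q) (Fin q) ℂ :=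
  blockCol (fun i => sA a s (j + i)) j

/-- The Schur complement `Ĥ_{1,j}`. -/
def hatH1 {q : ℕ} (s : ℕ → Matrix (Fin q) (Fin q) ℂ) : ℕ → Matrix (Fin q) (Fin q) ℂ
  | 0 => s 0
  | j + 1 => s (2 * (j + 1)) - (Y1 s (j + 1))ᴴ * (H1 s j)⁻¹ * Y1 s (j + 1)

/-- The Schur complement `Ĥ_{2,j}`. -/
def hatH2 {q : ℕ} (a b : ℝ) (s : ℕ → Matrix (Fin q) (Fin q) ℂ) : ℕ → Matrix (Fin q) (Fin q) ℂ
  | 0 => sHat a b s 0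
  | j + 1 => sHat a b s (2 * (j + 1)) -
      (Y2 a b s (j + 1))ᴴ * (H2 a b s j)⁻¹ * Y2 a b s (j + 1)

/-- The Schur complement `K̂_{1,j}`. -/
def hatK1 {q : ℕ} (b : ℝ) (s : ℕ → Matrix (Fin q) (Fin q) ℂ) : ℕ → Matrix (Fin q) (Fin q) ℂ
  | 0 => sB b s 0
  | j + 1 => sB b s (2 * (j + 1)) - (Yt1 b s (j + 1))ᴴ * (K1 b s j)⁻¹ * Yt1 b s (j + 1)

/-- The Schur complement `K̂_{2,j}`. -/
def hatK2 {q : ℕ} (a : ℝ) (s : ℕ → Matrix (Fin q) (Fin q) ℂ) : ℕ → Matrix (Fin q) (Fin q) ℂ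
  | 0 => sA a s 0
  | j + 1 => sA a s (2 * (j + 1)) - (Yt2 a s (j + 1))ᴴ * (K2 a s j)⁻¹ * Yt2 a s (j + 1)

/-- The block shift `T_j`, with `I_q` on the first block subdiagonal (`T_0 = 0`). -/
def T (q j : ℕ) : Matrix (Fin (j + 1) × Fin q) (Fin (j + 1) × Fin q) ℂ :=
  Matrix.of fun x y => if (x.1 : ℕ) = (y.1 : ℕ) + 1 ∧ x.2 = y.2 then 1 else 0

/-- `R_j(z) = (I - z T_j)⁻¹`. -/
def R (q j : ℕ) (z : ℂ) : Matrix (Fin (j + 1) × Fin q) (Fin (j + 1) × Fin q) ℂ :=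
  (1 - z • T q j)⁻¹

/-- `v_j`, the block column `(I_q, 0, …, 0)`. -/
def v (q j : ℕ) : Matrix (Fin (j + 1) × Fin q) (Fin q) ℂ :=
  blockCol (fun i => if i = 0 then 1 else 0) (j + 1)

/-- `u_{2,j}`, the block column `(-(a+b) s_0 + s_1, -ŝ_0, …, -ŝ_{j-1})`. -/
def u2 {q : ℕ} (a b : ℝ) (s : ℕ → Matrix (Fin q) (Fin q) ℂ) (j : ℕ) :
    Matrix (Fin (j + 1) × Fin q) (Fin q) ℂ :=
  blockCol (fun i =>
    if i = 0 then -((a : ℂ) + (b : ℂ)) • s 0 + s 1 else -sHat a b s (i - 1)) (j + 1)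

/-- `ũ_{2,j}`, the block column `(-s_0, -s_1 + a s_0, …, -s_j + a s_{j-1})`. -/
def ut2 {q : ℕ} (a : ℝ) (s : ℕ → Matrix (Fin q) (Fin q) ℂ) (j : ℕ) :
    Matrix (Fin (j + 1) × Fin q) (Fin q) ℂ :=
  blockCol (fun i => if i = 0 then -s 0 else -s i + (a : ℂ) • s (i - 1)) (j + 1)

/-- The matrix polynomial `P_{1,j}`. -/
def P1 {q : ℕ} (s : ℕ → Matrix (Fin q) (Fin q) ℂ) : ℕ → ℂ → Matrix (Fin q) (Fin q) ℂ
  | 0, _ => 1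
  | j + 1, z => rowI (-((Y1 s (j + 1))ᴴ * (H1 s j)⁻¹)) * R q (j + 1) z * v q (j + 1)

/-- The matrix polynomial `Q_{2,j}`. -/
def Q2 {q : ℕ} (a b : ℝ) (s : ℕ → Matrix (Fin q) (Fin q) ℂ) :
    ℕ → ℂ → Matrix (Fin q) (Fin q) ℂ
  | 0, z => -((-((a : ℂ) + (b : ℂ)) • s 0 + s 1) + z • s 0)
  | j + 1, z => -(rowI (-((Y2 a b s (j + 1))ᴴ * (H2 a b s j)⁻¹)) * R q (j + 1) z *
      (u2 a b s (j + 1) + z • (v q (j + 1) * s 0)))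

/-- The matrix polynomial `Γ_{1,j}`. -/
def Gamma1 {q : ℕ} (b : ℝ) (s : ℕ → Matrix (Fin q) (Fin q) ℂ) :
    ℕ → ℂ → Matrix (Fin q) (Fin q) ℂ
  | 0, _ => 1
  | j + 1, z => rowI (-((Yt1 b s (j + 1))ᴴ * (K1 b s j)⁻¹)) * R q (j + 1) z * v q (j + 1)

/-- The matrix polynomial `Θ_{2,j}`. -/
def Theta2 {q : ℕ} (a : ℝ) (s : ℕ → Matrix (Fin q) (Fin q) ℂ) :
    ℕ → ℂ → Matrix (Fin q) (Fin q) ℂ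
  | 0, _ => -s 0
  | j + 1, z => rowI (-((Yt2 a s (j + 1))ᴴ * (K2 a s j)⁻¹)) * R q (j + 1) z * ut2 a s (j + 1)

/-- `v_j^* R_j(a)^* K_{1,j}⁻¹ R_j(a) v_j`. -/
def dsmT {q : ℕ} (a b : ℝ) (s : ℕ → Matrix (Fin q) (Fin q) ℂ) (j : ℕ) :
    Matrix (Fin q) (Fin q) ℂ :=
  (v q j)ᴴ * (R q j a)ᴴ * (K1 b s j)⁻¹ * R q j a * v q j

/-- `(u_{2,j}^* + a s_0 v_j^*) R_j(a)^* H_{2,j}⁻¹ R_j(a) (u_{2,j} + a v_j s_0)`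
(for `j = 0` the factors `R_0(a)` are the identity). -/
def dsmG {q : ℕ} (a b : ℝ) (s : ℕ → Matrix (Fin q) (Fin q) ℂ) (j : ℕ) :
    Matrix (Fin q) (Fin q) ℂ :=
  ((u2 a b s j)ᴴ + (a : ℂ) • (s 0 * (v q j)ᴴ)) * (R q j a)ᴴ * (H2 a b s j)⁻¹ * R q j a *
    (u2 a b s j + (a : ℂ) • (v q j * s 0))

/-- The Dyukarev–Stieltjes matrix parameter `𝐦_j`. -/
def dsmM {q : ℕ} (a b : ℝ) (s : ℕ → Matrix (Fin q) (Fin q) ℂ) : ℕ → Matrix (Fin q) (Fin q) ℂ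
  | 0 => dsmT a b s 0
  | j + 1 => dsmT a b s (j + 1) - dsmT a b s j

/-- The Dyukarev–Stieltjes matrix parameter `𝐥_j`. -/
def dsmL {q : ℕ} (a b : ℝ) (s : ℕ → Matrix (Fin q) (Fin q) ℂ) : ℕ → Matrix (Fin q) (Fin q) ℂ
  | 0 => dsmG a b s 0
  | j + 1 => dsmG a b s (j + 1) - dsmG a b s j

/-- The right product `A_0 A_1 ⋯ A_{N-1}` of `N` factors (`I_q` for `N = 0`). -/
def prodRight {q : ℕ} (A : ℕ → Matrix (Fin q) (Fin q) ℂ) (N : ℕ) : Matrix (Fin q) (Fin q) ℂ :=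
  ((List.range N).map A).prod

/-- The left product `A_{N-1} ⋯ A_1 A_0` of `N` factors (`I_q` for `N = 0`). -/
def prodLeft {q : ℕ} (A : ℕ → Matrix (Fin q) (Fin q) ℂ) (N : ℕ) : Matrix (Fin q) (Fin q) ℂ :=
  ((List.range N).reverse.map A).prod

end

end THMM

/-!
The Schur complements of the block Hankel matrices are the norms of the monic orthogonal matrix
polynomials. Multiplying the weight by `x - a` turns `s` into `sA a s` and `sB b s` into
`sHat a b s`, and Christoffel's formula together with its converse relates the orthogonal
polynomials `p`, `r` before and after this multiplication:
`p (j + 1) = (x - a) r j - c p j` and `r (j + 1) = p (j + 1) - c' r j`, where `c` and `c'` are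
quotients of norms. Evaluating the first relation at `a` gives the products for `P1` and `Gamma1`,
and taking the moments of the second gives those for `Theta2` and `Q2`.

The DSM parameters are increments of Christoffel–Darboux kernels, hence congruences of the inverse
norms by `Gamma1` and `Q2` at `a`. If `Ψ j` denotes the product of the `(hatH2 k)⁻¹ * hatK1 k` with
`k < j`, they become `m j = (Ψ j)⁻¹ (hatK1 j)⁻¹ (Ψ j)⁻¹ᴴ` and
`l j = (Ψ (j + 1))ᴴ (hatH2 j) (Ψ (j + 1))`. Hence `m k * l k = (Ψ k)⁻¹ * Ψ (k + 1)`, and the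
products of the `(m k * l k)⁻¹` telescope.
-/

namespace THMM

open Polynomial

noncomputable section

section MonicOrthogonal

variable {k A : Type*} [CommRing k] [Ring A] [Algebra k A]

/-- The left linear functional `∑ cᵢ Xⁱ ↦ ∑ cᵢ fᵢ` with moments `f`. The coefficients stand on the
left of the moments, so orthogonality below is orthogonality of left polynomials. -/
def momentFunctional (f : ℕ → A) : A[X] →ₗ[A] A :=
  lsum fun i => LinearMap.toSpanSingleton A A (f i)

lemma momentFunctional_apply (f : ℕ → A) (p : A[X]) :
    momentFunctional f p = p.sum fun i c => c * f i := rfl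

@[simp]
lemma momentFunctional_monomial (f : ℕ → A) (n : ℕ) (c : A) :
    momentFunctional f (monomial n c) = c * f n := by
  rw [momentFunctional_apply, sum_monomial_index _ _ (zero_mul (f n))]

lemma momentFunctional_X_pow (f : ℕ → A) (n : ℕ) : momentFunctional f (X ^ n) = f n := by
  rw [X_pow_eq_monomial, momentFunctional_monomial, one_mul]

lemma momentFunctional_pow (x : A) (p : A[X]) :
    momentFunctional (fun i => x ^ i) p = p.eval x := by
  rw [momentFunctional_apply, eval_eq_sum]

lemma momentFunctional_mul_X_pow (f : ℕ → A) (p : A[X]) (n : ℕ) :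
    momentFunctional f (p * X ^ n) = momentFunctional (fun i => f (i + n)) p := by
  induction p using Polynomial.induction_on' with
  | add p r hp hr => rw [add_mul, map_add, map_add, hp, hr]
  | monomial i c => simp [monomial_mul_X_pow]

/-- The moments of the functional with moments `f` multiplied by the weight `X - α`. -/
def christoffel (α : k) (f : ℕ → A) (i : ℕ) : A := f (i + 1) - α • f i

lemma mul_X_sub_C_algebraMap (α : k) (p : A[X]) :
    p * (X - C (algebraMap k A α)) = p * X - α • p := by
  rw [mul_sub, ← Polynomial.algebraMap_apply, ← Algebra.commutes, ← Algebra.smul_def]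

lemma momentFunctional_christoffel (α : k) (f : ℕ → A) (p : A[X]) :
    momentFunctional (christoffel α f) p =
      momentFunctional f (p * (X - C (algebraMap k A α))) := by
  rw [mul_X_sub_C_algebraMap, map_sub, LinearMap.map_smul_of_tower]
  induction p using Polynomial.induction_on' with
  | add p r hp hr => rw [add_mul, map_add, map_add, map_add, hp, hr, smul_add, add_sub_add_comm]
  | monomial i c => simp [christoffel, monomial_mul_X, mul_sub]

lemma momentFunctional_christoffel_mul_X_pow (α : k) (f : ℕ → A) (p : A[X]) (n : ℕ) :
    momentFunctional (christoffel α f) (p * X ^ n) =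
      momentFunctional f (p * X ^ (n + 1)) - α • momentFunctional f (p * X ^ n) := by
  rw [momentFunctional_christoffel, mul_X_sub_C_algebraMap, map_sub,
    LinearMap.map_smul_of_tower, mul_assoc, pow_succ]

/-- `p` is a monic polynomial of degree `j` (formally so if `A` is trivial) that is orthogonal, for
the functional with moments `f`, to all lower powers of `X`. -/
structure IsMonicOrthogonal (f : ℕ → A) (j : ℕ) (p : A[X]) : Prop where
  sub_X_pow_mem : p - X ^ j ∈ degreeLT A j
  moment_eq_zero : ∀ n < j, momentFunctional f (p * X ^ n) = 0

/-- The Gram form of the functional with moments `f` is nondegenerate on polynomials of degree less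
than `N`. -/
def MomentNondegenerate (f : ℕ → A) (N : ℕ) : Prop :=
  ∀ p ∈ degreeLT A N, (∀ n < N, momentFunctional f (p * X ^ n) = 0) → p = 0

lemma degreeLT_le_succ (N : ℕ) : degreeLT A N ≤ degreeLT A (N + 1) :=
  degreeLT_mono N.le_succ

lemma mul_X_mem_degreeLT_succ {N : ℕ} {p : A[X]} (hp : p ∈ degreeLT A N) :
    p * X ∈ degreeLT A (N + 1) := by
  rw [mem_degreeLT, degree_lt_iff_coeff_zero] at hp ⊢
  intro n hn
  obtain ⟨n, rfl⟩ : ∃ n', n = n' + 1 := ⟨n - 1, by omega⟩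
  rw [coeff_mul_X]
  exact hp n (by omega)

namespace IsMonicOrthogonal

variable {f : ℕ → A} {α : k} {c : A} {j : ℕ} {p p' r r' : A[X]}

lemma mem_degreeLT_succ (hp : IsMonicOrthogonal f j p) : p ∈ degreeLT A (j + 1) := by
  have hX : (X ^ j : A[X]) ∈ degreeLT A (j + 1) :=
    mem_degreeLT.2 ((degree_X_pow_le j).trans_lt (by exact_mod_cast j.lt_succ_self))
  simpa only [sub_add_cancel] using
    add_mem (degreeLT_le_succ j hp.sub_X_pow_mem) hX

lemma moment_zero_eq_zero (hp : IsMonicOrthogonal f (j + 1) p) : momentFunctional f p = 0 := by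
  simpa only [pow_zero, mul_one] using hp.moment_eq_zero 0 j.succ_pos

protected lemma unique (hf : MomentNondegenerate f j) (hp : IsMonicOrthogonal f j p)
    (hp' : IsMonicOrthogonal f j p') : p = p' := by
  refine sub_eq_zero.1 (hf _ ?_ fun n hn => ?_)
  · simpa only [sub_sub_sub_cancel_right] using sub_mem hp.sub_X_pow_mem hp'.sub_X_pow_mem
  · rw [sub_mul, map_sub, hp.moment_eq_zero n hn, hp'.moment_eq_zero n hn, sub_zero]

lemma mul_X_sub_C_sub_smul (hp : IsMonicOrthogonal f j p)
    (hr : IsMonicOrthogonal (christoffel α f) j r)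
    (hc : c * momentFunctional f (p * X ^ j) =
      momentFunctional (christoffel α f) (r * X ^ j)) :
    IsMonicOrthogonal f (j + 1) (r * (X - C (algebraMap k A α)) - c • p) where
  sub_X_pow_mem := by
    have hsplit : r * (X - C (algebraMap k A α)) - c • p - X ^ (j + 1) =
        (r - X ^ j) * X - algebraMap k A α • r - c • p := by
      rw [mul_X_sub_C_algebraMap, sub_mul, algebraMap_smul, pow_succ]
      abel
    rw [hsplit]
    exact sub_mem (sub_mem (mul_X_mem_degreeLT_succ hr.sub_X_pow_mem)
      (Submodule.smul_mem _ _ hr.mem_degreeLT_succ)) (Submodule.smul_mem _ _ hp.mem_degreeLT_succ)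
  moment_eq_zero n hn := by
    have hcomm : r * (X - C (algebraMap k A α)) * X ^ n =
        r * X ^ n * (X - C (algebraMap k A α)) := by
      rw [mul_assoc, ← X_pow_mul, mul_assoc]
    rw [sub_mul, hcomm, map_sub, ← momentFunctional_christoffel, smul_mul_assoc, map_smul,
      smul_eq_mul]
    rcases Nat.lt_succ_iff_lt_or_eq.1 hn with hn | rfl
    · rw [hp.moment_eq_zero n hn, hr.moment_eq_zero n hn, mul_zero, sub_zero]
    · rw [hc, sub_self]

/-- Only the top moment of `p'` for the weight `X - α` survives, and `c` is chosen to cancel it. -/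
lemma sub_smul_christoffel (hp' : IsMonicOrthogonal f (j + 1) p')
    (hr : IsMonicOrthogonal (christoffel α f) j r)
    (hc : c * momentFunctional (christoffel α f) (r * X ^ j) =
      momentFunctional f (p' * X ^ (j + 1))) :
    IsMonicOrthogonal (christoffel α f) (j + 1) (p' - c • r) where
  sub_X_pow_mem := by
    rw [sub_right_comm]
    exact sub_mem hp'.sub_X_pow_mem (Submodule.smul_mem _ _ hr.mem_degreeLT_succ)
  moment_eq_zero n hn := by
    rw [sub_mul, map_sub, momentFunctional_christoffel_mul_X_pow, hp'.moment_eq_zero n hn,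
      smul_mul_assoc, map_smul, smul_eq_mul, smul_zero, sub_zero]
    rcases Nat.lt_succ_iff_lt_or_eq.1 hn with hn | rfl
    · rw [hp'.moment_eq_zero (n + 1) (by omega), hr.moment_eq_zero n hn, mul_zero, sub_zero]
    · rw [hc, sub_self]

/-- Evaluating Christoffel's formula at the node `α` kills the term carrying `X - α`. -/
lemma eval_succ (hf : MomentNondegenerate f (j + 1)) (hp : IsMonicOrthogonal f j p)
    (hp' : IsMonicOrthogonal f (j + 1) p') (hr : IsMonicOrthogonal (christoffel α f) j r)
    (hc : c * momentFunctional f (p * X ^ j) =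
      momentFunctional (christoffel α f) (r * X ^ j)) :
    p'.eval (algebraMap k A α) = -(c * p.eval (algebraMap k A α)) := by
  rw [hp'.unique hf (hp.mul_X_sub_C_sub_smul hr hc), eval_sub, eval_mul_X_sub_C, eval_smul,
    zero_sub, smul_eq_mul]

lemma momentFunctional_christoffel_succ (hg : MomentNondegenerate (christoffel α f) (j + 1))
    (hp' : IsMonicOrthogonal f (j + 1) p') (hr : IsMonicOrthogonal (christoffel α f) j r)
    (hr' : IsMonicOrthogonal (christoffel α f) (j + 1) r')
    (hc : c * momentFunctional (christoffel α f) (r * X ^ j) =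
      momentFunctional f (p' * X ^ (j + 1))) :
    momentFunctional f r' = -(c * momentFunctional f r) := by
  rw [hr'.unique hg (hp'.sub_smul_christoffel hr hc), map_sub, hp'.moment_zero_eq_zero, map_smul,
    zero_sub, smul_eq_mul]

end IsMonicOrthogonal

end MonicOrthogonal

section SchurComplement

open Matrix

variable {l m n p : Type*} [Fintype m] [DecidableEq m]

lemma fromCols_mul_inv_fromBlocks_mul_fromRows [Fintype n] [DecidableEq n] {𝕜 : Type*}
    [CommRing 𝕜] {A : Matrix m m 𝕜} {B : Matrix m n 𝕜} {C : Matrix n m 𝕜} {D : Matrix n n 𝕜}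
    (hA : IsUnit A) (hS : IsUnit (D - C * A⁻¹ * B)) (x : Matrix l m 𝕜) (y : Matrix l n 𝕜)
    (z : Matrix m p 𝕜) (w : Matrix n p 𝕜) :
    fromCols x y * (fromBlocks A B C D)⁻¹ * fromRows z w =
      x * A⁻¹ * z + (y - x * A⁻¹ * B) * (D - C * A⁻¹ * B)⁻¹ * (w - C * A⁻¹ * z) := by
  let := hA.invertible
  let : Invertible (D - C * ⅟A * B) := (invOf_eq_nonsing_inv A ▸ hS).invertible
  let := fromBlocks₁₁Invertible A B C D
  have hinv := invOf_fromBlocks₁₁_eq A B C D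
  simp only [invOf_eq_nonsing_inv] at hinv
  rw [hinv, fromCols_mul_fromBlocks, fromCols_mul_fromRows]
  simp only [Matrix.mul_add, Matrix.add_mul, Matrix.mul_sub, Matrix.sub_mul, Matrix.mul_neg,
    Matrix.neg_mul, Matrix.mul_assoc]
  abel

lemma posDef_schurComplement_of_fromBlocks [Finite n] {𝕜 : Type*} [RCLike 𝕜] {A : Matrix m m 𝕜}
    {B : Matrix m n 𝕜} {D : Matrix n n 𝕜} (h : (fromBlocks A B Bᴴ D).PosDef) :
    (D - Bᴴ * A⁻¹ * B).PosDef := by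
  classical
  have := Fintype.ofFinite n
  have hA : A.PosDef := h.submatrix (e := Sum.inl) Sum.inl_injective
  let := hA.isUnit.invertible
  have hsemi := (hA.fromBlocks₁₁ B D).1 h.posSemidef
  refine hsemi.posDef_iff_isUnit.2 ?_
  rw [← invOf_eq_nonsing_inv]
  exact isUnit_fromBlocks_iff_of_invertible₁₁.1 h.isUnit

end SchurComplement

section BlockHankel

variable {q : ℕ} {N : ℕ}

/-- The block Hankel matrix with `N` block rows; unlike `hankel`, it may be empty. -/
def blockHankel (f : ℕ → Matrix (Fin q) (Fin q) ℂ) (N : ℕ) :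
    Matrix (Fin N × Fin q) (Fin N × Fin q) ℂ :=
  Matrix.of fun x y => f (x.1 + y.1) x.2 y.2

/-- The matrix polynomial whose coefficients are the blocks of a block row. -/
def rowPoly (B : Matrix (Fin q) (Fin N × Fin q) ℂ) : (Matrix (Fin q) (Fin q) ℂ)[X] :=
  ∑ i : Fin N, monomial i (B.submatrix id (Prod.mk i))

lemma momentFunctional_rowPoly (e : ℕ → Matrix (Fin q) (Fin q) ℂ)
    (B : Matrix (Fin q) (Fin N × Fin q) ℂ) :
    momentFunctional e (rowPoly B) = B * blockCol e N := by
  ext r c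
  simp [rowPoly, blockCol, Matrix.mul_apply, Matrix.sum_apply, Fintype.sum_prod_type]

lemma momentFunctional_rowPoly_mul_X_pow (f : ℕ → Matrix (Fin q) (Fin q) ℂ)
    (B : Matrix (Fin q) (Fin N × Fin q) ℂ) (n : Fin N) :
    momentFunctional f (rowPoly B * X ^ (n : ℕ)) =
      (B * blockHankel f N).submatrix id (Prod.mk n) := by
  rw [momentFunctional_mul_X_pow, momentFunctional_rowPoly]
  rfl

lemma rowPoly_mem_degreeLT (B : Matrix (Fin q) (Fin N × Fin q) ℂ) :
    rowPoly B ∈ degreeLT (Matrix (Fin q) (Fin q) ℂ) N :=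
  sum_mem fun i _ => mem_degreeLT.2 ((degree_monomial_le _ _).trans_lt (by exact_mod_cast i.2))

lemma exists_rowPoly_eq {p : (Matrix (Fin q) (Fin q) ℂ)[X]}
    (hp : p ∈ degreeLT (Matrix (Fin q) (Fin q) ℂ) N) :
    ∃ B : Matrix (Fin q) (Fin N × Fin q) ℂ, rowPoly B = p :=
  ⟨Matrix.of fun r x => p.coeff x.1 r x.2,
    (sum_fin (fun i c => monomial i c) (fun i => monomial_zero_right i)
      (mem_degreeLT.1 hp)).trans p.sum_monomial_eq⟩

lemma momentNondegenerate_of_isUnit {f : ℕ → Matrix (Fin q) (Fin q) ℂ}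
    (hf : IsUnit (blockHankel f N)) : MomentNondegenerate f N := by
  intro p hp h
  obtain ⟨B, rfl⟩ := exists_rowPoly_eq hp
  have hB : B * blockHankel f N = 0 := by
    ext r ⟨n, c⟩
    have hn := h n n.2
    rw [momentFunctional_rowPoly_mul_X_pow] at hn
    exact congrFun (congrFun hn r) c
  have hB0 : B = 0 := by
    rw [← Matrix.mul_nonsing_inv_cancel_right _ B ((Matrix.isUnit_iff_isUnit_det _).1 hf), hB,
      Matrix.zero_mul]
  simp [hB0, rowPoly]

lemma isHermitian_of_blockHankel {f : ℕ → Matrix (Fin q) (Fin q) ℂ}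
    (h : (blockHankel f N).IsHermitian) {i : ℕ} (hi : i + 1 < 2 * N) : (f i).IsHermitian := by
  have hblock := congrArg (Matrix.submatrix · (Prod.mk (⟨i / 2, by omega⟩ : Fin N))
    (Prod.mk (⟨i - i / 2, by omega⟩ : Fin N))) h
  ext r c
  simpa [blockHankel, show i - i / 2 + i / 2 = i by omega, show i / 2 + (i - i / 2) = i by omega]
    using congrFun (congrFun hblock r) c

lemma blockHankel_posDef_mono {f : ℕ → Matrix (Fin q) (Fin q) ℂ} {M : ℕ}
    (h : (blockHankel f M).PosDef) (hNM : N ≤ M) : (blockHankel f N).PosDef :=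
  h.submatrix (e := Prod.map (Fin.castLE hNM) id)
    ((Fin.castLE_injective hNM).prodMap Function.injective_id)

end BlockHankel

section OrthogonalPolynomials

variable {q : ℕ} (f e : ℕ → Matrix (Fin q) (Fin q) ℂ) (j : ℕ)

/-- The row `-Y^* H⁻¹` of the coefficients of degree less than `j` of the monic orthogonal
polynomial of degree `j`. -/
def orthRow : Matrix (Fin q) (Fin j × Fin q) ℂ :=
  -((blockCol (fun i => f (j + i)) j)ᴴ * (blockHankel f j)⁻¹)

/-- The monic orthogonal matrix polynomial of degree `j` of the sequence of moments `f`. -/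
def orthPoly : (Matrix (Fin q) (Fin q) ℂ)[X] :=
  rowPoly (orthRow f j) + X ^ j

/-- The Schur complement of `blockHankel f j` in `blockHankel f (j + 1)`. -/
def schur : Matrix (Fin q) (Fin q) ℂ :=
  f (2 * j) - (blockCol (fun i => f (j + i)) j)ᴴ * (blockHankel f j)⁻¹ *
    blockCol (fun i => f (j + i)) j

lemma momentFunctional_orthPoly :
    momentFunctional e (orthPoly f j) = orthRow f j * blockCol e j + e j := by
  rw [orthPoly, map_add, momentFunctional_rowPoly, momentFunctional_X_pow]

lemma momentFunctional_orthPoly_mul_X_pow_self :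
    momentFunctional f (orthPoly f j * X ^ j) = schur f j := by
  rw [momentFunctional_mul_X_pow, momentFunctional_orthPoly, orthRow, schur, two_mul,
    Matrix.neg_mul, neg_add_eq_sub]
  simp only [add_comm]

lemma orthPoly_zero : orthPoly f 0 = 1 := by
  simp [orthPoly, rowPoly]

lemma schur_zero : schur f 0 = f 0 := by
  rw [← momentFunctional_orthPoly_mul_X_pow_self, orthPoly_zero, one_mul, momentFunctional_X_pow]

variable {f j}

lemma isMonicOrthogonal_orthPoly (hf : (blockHankel f j).PosDef)
    (hH : ∀ i < 2 * j, (f i).IsHermitian) : IsMonicOrthogonal f j (orthPoly f j) where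
  sub_X_pow_mem := by
    rw [orthPoly, add_sub_cancel_right]
    exact rowPoly_mem_degreeLT _
  moment_eq_zero n hn := by
    have hrow : orthRow f j * blockHankel f j = -(blockCol (fun i => f (j + i)) j)ᴴ := by
      rw [orthRow, Matrix.neg_mul, Matrix.nonsing_inv_mul_cancel_right _ _
        hf.det_pos.ne'.isUnit]
    have hblock : (blockCol (fun i => f (j + i)) j)ᴴ.submatrix id (Prod.mk (⟨n, hn⟩ : Fin j)) =
        f (j + n) := hH (j + n) (by omega)
    rw [orthPoly, add_mul, map_add, momentFunctional_rowPoly_mul_X_pow f _ ⟨n, hn⟩, hrow,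
      Matrix.submatrix_neg, Pi.neg_apply, Pi.neg_apply, hblock, ← pow_add, momentFunctional_X_pow,
      neg_add_cancel]

end OrthogonalPolynomials

section Schur

variable {q j : ℕ} {f : ℕ → Matrix (Fin q) (Fin q) ℂ}

/-- Splits the last block off the index set of a block vector. -/
def lastBlockEquiv (q j : ℕ) : (Fin j × Fin q) ⊕ Fin q ≃ Fin (j + 1) × Fin q :=
  (Equiv.sumCongr (Equiv.refl _) (Equiv.uniqueProd (Fin q) (Fin 1)).symm).trans
    ((Equiv.sumProdDistrib (Fin j) (Fin 1) (Fin q)).symm.trans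
      (finSumFinEquiv.prodCongr (Equiv.refl _)))

lemma blockCol_succ_submatrix (e : ℕ → Matrix (Fin q) (Fin q) ℂ) :
    (blockCol e (j + 1)).submatrix (lastBlockEquiv q j) id =
      Matrix.fromRows (blockCol e j) (e j) := by
  ext (x | c) y <;> simp [lastBlockEquiv, blockCol]

lemma blockHankel_succ_submatrix (hf : (blockHankel f (j + 1)).IsHermitian) :
    (blockHankel f (j + 1)).submatrix (lastBlockEquiv q j) (lastBlockEquiv q j) =
      Matrix.fromBlocks (blockHankel f j) (blockCol (fun i => f (j + i)) j)
        (blockCol (fun i => f (j + i)) j)ᴴ (f (2 * j)) := by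
  ext (⟨i, r⟩ | r) (⟨k, c⟩ | c)
  · simp [lastBlockEquiv, blockHankel]
  · simp [lastBlockEquiv, blockHankel, blockCol, add_comm]
  · have hjk : (f (j + k))ᴴ r c = f (j + k) r c :=
      congrFun (congrFun (isHermitian_of_blockHankel hf (by omega)) r) c
    simpa [lastBlockEquiv, blockHankel, blockCol] using hjk.symm
  · simp [lastBlockEquiv, blockHankel, two_mul]

lemma schur_posDef (hf : (blockHankel f (j + 1)).PosDef) : (schur f j).PosDef := by
  apply posDef_schurComplement_of_fromBlocks
  rw [← blockHankel_succ_submatrix hf.isHermitian]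
  exact hf.submatrix (lastBlockEquiv q j).injective

/-- The Christoffel–Darboux kernel `e^* H⁻¹ e` of the block Hankel matrix `H` with `N` block rows,
at the block column `e`. -/
def hankelInvForm (f e : ℕ → Matrix (Fin q) (Fin q) ℂ) (N : ℕ) : Matrix (Fin q) (Fin q) ℂ :=
  (blockCol e N)ᴴ * (blockHankel f N)⁻¹ * blockCol e N

lemma hankelInvForm_zero (f e : ℕ → Matrix (Fin q) (Fin q) ℂ) : hankelInvForm f e 0 = 0 := by
  ext r c
  simp [hankelInvForm, Matrix.mul_apply]

lemma hankelInvForm_succ (hf : (blockHankel f (j + 1)).PosDef)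
    (e : ℕ → Matrix (Fin q) (Fin q) ℂ) :
    hankelInvForm f e (j + 1) = hankelInvForm f e j +
      (momentFunctional e (orthPoly f j))ᴴ * (schur f j)⁻¹ *
        momentFunctional e (orthPoly f j) := by
  have hj := blockHankel_posDef_mono hf j.le_succ
  have hconj : (momentFunctional e (orthPoly f j))ᴴ = (e j)ᴴ -
      (blockCol e j)ᴴ * (blockHankel f j)⁻¹ * blockCol (fun i => f (j + i)) j := by
    rw [momentFunctional_orthPoly, orthRow, Matrix.neg_mul, neg_add_eq_sub,
      Matrix.conjTranspose_sub, Matrix.conjTranspose_mul, Matrix.conjTranspose_mul,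
      Matrix.conjTranspose_conjTranspose, hj.isHermitian.inv.eq, Matrix.mul_assoc]
  have hform := fromCols_mul_inv_fromBlocks_mul_fromRows hj.isUnit (schur_posDef hf).isUnit
    (blockCol e j)ᴴ (e j)ᴴ (blockCol e j) (e j)
  rw [← blockHankel_succ_submatrix hf.isHermitian,
    ← Matrix.conjTranspose_fromRows_eq_fromCols_conjTranspose, ← blockCol_succ_submatrix,
    Matrix.inv_submatrix_equiv, Matrix.conjTranspose_submatrix, Matrix.submatrix_mul_equiv,
    Matrix.submatrix_mul_equiv, Matrix.submatrix_id_id] at hform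
  rw [hankelInvForm, hform, hconj, momentFunctional_orthPoly, orthRow, Matrix.neg_mul,
    neg_add_eq_sub]
  rfl

end Schur

section Products

variable {q : ℕ} (A : ℕ → Matrix (Fin q) (Fin q) ℂ) (N : ℕ)

lemma prodLeft_zero : prodLeft A 0 = 1 := rfl

lemma prodRight_zero : prodRight A 0 = 1 := rfl

lemma prodLeft_succ : prodLeft A (N + 1) = A N * prodLeft A N := by
  simp [prodLeft, List.range_succ]

lemma prodRight_succ : prodRight A (N + 1) = prodRight A N * A N := by
  simp [prodRight, List.range_succ]

end Products

section Christoffel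

variable {q j : ℕ} {a : ℝ} {f : ℕ → Matrix (Fin q) (Fin q) ℂ}

lemma sA_eq_christoffel (a : ℝ) (f : ℕ → Matrix (Fin q) (Fin q) ℂ) :
    sA a f = christoffel (a : ℂ) f := by
  funext i
  rw [sA, christoffel, neg_smul, neg_add_eq_sub]

lemma isHermitian_sA {i : ℕ} (a : ℝ) (h : (f i).IsHermitian) (h' : (f (i + 1)).IsHermitian) :
    (sA a f i).IsHermitian :=
  (h.smul (k := -(a : ℂ)) (IsSelfAdjoint.neg (Complex.conj_ofReal a))).add h'

theorem eval_orthPoly (hf : (blockHankel f j).PosDef) (hg : (blockHankel (sA a f) j).PosDef)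
    (hH : ∀ i < 2 * j, (f i).IsHermitian) :
    (orthPoly f j).eval (algebraMap ℂ (Matrix (Fin q) (Fin q) ℂ) a) =
      (-1 : ℂ) ^ j • prodLeft (fun k => schur (sA a f) k * (schur f k)⁻¹) j := by
  induction j with
  | zero => rw [orthPoly_zero, eval_one, pow_zero, one_smul, prodLeft_zero]
  | succ j ih =>
    have hfj := blockHankel_posDef_mono hf j.le_succ
    have hgj := blockHankel_posDef_mono hg j.le_succ
    have hr : IsMonicOrthogonal (sA a f) j (orthPoly (sA a f) j) :=
      isMonicOrthogonal_orthPoly hgj fun i hi =>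
        isHermitian_sA a (hH i (by omega)) (hH (i + 1) (by omega))
    have hc : schur (sA a f) j * (schur f j)⁻¹ * momentFunctional f (orthPoly f j * X ^ j) =
        momentFunctional (sA a f) (orthPoly (sA a f) j * X ^ j) := by
      rw [momentFunctional_orthPoly_mul_X_pow_self, momentFunctional_orthPoly_mul_X_pow_self,
        Matrix.nonsing_inv_mul_cancel_right _ _ (schur_posDef hf).det_pos.ne'.isUnit]
    rw [sA_eq_christoffel] at hr hc
    rw [IsMonicOrthogonal.eval_succ (momentNondegenerate_of_isUnit hf.isUnit)
      (isMonicOrthogonal_orthPoly hfj fun i hi => hH i (by omega))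
      (isMonicOrthogonal_orthPoly hf hH) hr hc, ih hfj hgj fun i hi => hH i (by omega),
      prodLeft_succ, ← sA_eq_christoffel, Matrix.mul_smul, pow_succ, mul_neg_one, neg_smul]

theorem momentFunctional_orthPoly_sA (hf : (blockHankel f j).PosDef)
    (hg : (blockHankel (sA a f) j).PosDef) (hH : ∀ i ≤ 2 * j, (f i).IsHermitian) :
    momentFunctional f (orthPoly (sA a f) j) =
      (-1 : ℂ) ^ j • (schur f j * prodLeft (fun k => (schur (sA a f) k)⁻¹ * schur f k) j) := by
  induction j with
  | zero =>
    rw [orthPoly_zero, ← pow_zero X, momentFunctional_X_pow, schur_zero, prodLeft_zero, mul_one,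
      pow_zero, one_smul]
  | succ j ih =>
    have hfj := blockHankel_posDef_mono hf j.le_succ
    have hgj := blockHankel_posDef_mono hg j.le_succ
    have hgH : ∀ i < 2 * (j + 1), (sA a f i).IsHermitian := fun i hi =>
      isHermitian_sA a (hH i (by omega)) (hH (i + 1) (by omega))
    have hr : IsMonicOrthogonal (sA a f) j (orthPoly (sA a f) j) :=
      isMonicOrthogonal_orthPoly hgj fun i hi => hgH i (by omega)
    have hr' : IsMonicOrthogonal (sA a f) (j + 1) (orthPoly (sA a f) (j + 1)) :=
      isMonicOrthogonal_orthPoly hg hgH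
    have hnondeg : MomentNondegenerate (sA a f) (j + 1) := momentNondegenerate_of_isUnit hg.isUnit
    have hc : schur f (j + 1) * (schur (sA a f) j)⁻¹ *
        momentFunctional (sA a f) (orthPoly (sA a f) j * X ^ j) =
        momentFunctional f (orthPoly f (j + 1) * X ^ (j + 1)) := by
      rw [momentFunctional_orthPoly_mul_X_pow_self, momentFunctional_orthPoly_mul_X_pow_self,
        Matrix.nonsing_inv_mul_cancel_right _ _ (schur_posDef hg).det_pos.ne'.isUnit]
    have hrec : momentFunctional f (orthPoly (sA a f) (j + 1)) =
        -(schur f (j + 1) * (schur (sA a f) j)⁻¹ *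
          momentFunctional f (orthPoly (sA a f) j)) := by
      rw [sA_eq_christoffel] at hr hr' hc hnondeg ⊢
      exact IsMonicOrthogonal.momentFunctional_christoffel_succ hnondeg
        (isMonicOrthogonal_orthPoly hf fun i hi => hH i (by omega)) hr hr' hc
    rw [hrec, ih hfj hgj fun i hi => hH i (by omega), prodLeft_succ, Matrix.mul_smul, pow_succ,
      mul_neg_one, neg_smul]
    simp only [Matrix.mul_assoc]

end Christoffel

section Positivity

variable {q N : ℕ}

/-- The map from coefficients to coefficients that multiplies a vector polynomial by `X - c`. -/
def mulXSubMatrix (q N : ℕ) (c : ℝ) : Matrix (Fin (N + 1) × Fin q) (Fin N × Fin q) ℂ :=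
  (1 : Matrix _ _ ℂ).submatrix id (Prod.map Fin.succ id) -
    (c : ℂ) • (1 : Matrix _ _ ℂ).submatrix id (Prod.map Fin.castSucc id)

lemma one_submatrix_mulVec_apply {m n : Type*} [DecidableEq m] [Fintype n] {e : n → m}
    (he : Function.Injective e) (x : n → ℂ) (i : n) :
    ((1 : Matrix m m ℂ).submatrix id e *ᵥ x) (e i) = x i := by
  classical
  simp [Matrix.mulVec, dotProduct, Matrix.one_apply, he.eq_iff]

lemma one_submatrix_mul_mul_one_submatrix {m n : Type*} [Fintype m] [DecidableEq m]
    (M : Matrix m m ℂ) (e e' : n → m) :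
    (1 : Matrix m m ℂ).submatrix e id * M * (1 : Matrix m m ℂ).submatrix id e' =
      M.submatrix e e' := by
  ext i k
  simp [Matrix.mul_apply, Matrix.one_apply]

lemma mulXSubMatrix_mulVec_injective (c : ℝ) :
    Function.Injective (mulXSubMatrix q N c).mulVec := by
  refine (injective_iff_map_eq_zero (mulXSubMatrix q N c).mulVecLin).2 fun x hx => ?_
  have hsucc : Function.Injective (Prod.map Fin.succ id : Fin N × Fin q → Fin (N + 1) × Fin q) :=
    (Fin.succ_injective N).prodMap Function.injective_id
  have hcast : Function.Injective
      (Prod.map Fin.castSucc id : Fin N × Fin q → Fin (N + 1) × Fin q) :=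
    (Fin.castSucc_injective N).prodMap Function.injective_id
  let y := (1 : Matrix (Fin (N + 1) × Fin q) _ ℂ).submatrix id (Prod.map Fin.castSucc id) *ᵥ x
  have hycast (i : Fin N) (r : Fin q) : y (i.castSucc, r) = x (i, r) :=
    one_submatrix_mulVec_apply hcast x (i, r)
  have hxsucc (i : Fin N) (r : Fin q) : x (i, r) = c * y (i.succ, r) := by
    have h := congrFun hx (i.succ, r)
    rw [Matrix.mulVecLin_apply, mulXSubMatrix, Matrix.sub_mulVec, Matrix.smul_mulVec] at h
    exact (one_submatrix_mulVec_apply hsucc x (i, r)).symm.trans (sub_eq_zero.1 h)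
  have hy (i : Fin (N + 1)) (r : Fin q) : y (i, r) = 0 := by
    induction i using Fin.reverseInduction with
    | last =>
      simp [y, Matrix.mulVec, dotProduct, Prod.ext_iff, (Fin.castSucc_ne_last _).symm]
    | cast i ih => rw [hycast, hxsucc, ih, mul_zero]
  funext ⟨i, r⟩
  rw [← hycast, hy, Pi.zero_apply]

lemma mulXSubMatrix_conjTranspose_mul_blockHankel_mul (c : ℝ)
    (f : ℕ → Matrix (Fin q) (Fin q) ℂ) :
    (mulXSubMatrix q N c)ᴴ * blockHankel f (N + 1) * mulXSubMatrix q N c =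
      blockHankel (sA c (sA c f)) N := by
  simp only [mulXSubMatrix, Matrix.conjTranspose_sub, Matrix.conjTranspose_smul,
    Matrix.conjTranspose_submatrix, Matrix.conjTranspose_one, Matrix.sub_mul, Matrix.mul_sub,
    Matrix.smul_mul, Matrix.mul_smul, one_submatrix_mul_mul_one_submatrix]
  ext ⟨i, r⟩ ⟨k, t⟩
  simp only [blockHankel, RCLike.star_def, Complex.conj_ofReal, Complex.coe_smul, Matrix.sub_apply,
    Matrix.submatrix_apply, Prod.map_apply, id_eq, Matrix.of_apply, Fin.val_succ, ← add_assoc,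
    add_right_comm _ 1 (k : ℕ), Matrix.smul_apply, Fin.val_castSucc, Complex.real_smul, sA,
    neg_smul, smul_add, smul_neg, neg_neg, Matrix.add_apply, Matrix.neg_apply]
  ring

lemma blockHankel_sA_sA_posDef {f : ℕ → Matrix (Fin q) (Fin q) ℂ}
    (hf : (blockHankel f (N + 1)).PosDef) (c : ℝ) : (blockHankel (sA c (sA c f)) N).PosDef := by
  rw [← mulXSubMatrix_conjTranspose_mul_blockHankel_mul]
  exact hf.conjTranspose_mul_mul_same (mulXSubMatrix_mulVec_injective c)

lemma blockHankel_posDef_of_smul_eq_add {c : ℝ} (hc : 0 < c)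
    {f f₁ f₂ : ℕ → Matrix (Fin q) (Fin q) ℂ} (h : ∀ i, (c : ℂ) • f i = f₁ i + f₂ i)
    (h₁ : (blockHankel f₁ N).PosDef) (h₂ : (blockHankel f₂ N).PosDef) :
    (blockHankel f N).PosDef := by
  have hsmul : (c : ℂ) • blockHankel f N = blockHankel f₁ N + blockHankel f₂ N := by
    ext x y
    exact congrFun (congrFun (h (x.1 + y.1)) x.2) y.2
  have hM := (h₁.add h₂).smul (a := (c : ℂ)⁻¹) (inv_pos.2 (by exact_mod_cast hc))
  rwa [← hsmul, inv_smul_smul₀ (by exact_mod_cast hc.ne')] at hM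

variable {a b : ℝ} {s : ℕ → Matrix (Fin q) (Fin q) ℂ}

lemma sHat_eq_sA_sB (a b : ℝ) (s : ℕ → Matrix (Fin q) (Fin q) ℂ) :
    sHat a b s = sA a (sB b s) := by
  funext j
  simp only [sHat, sA, sB]
  module

/-- `(b - a) (b - x) = (x - a) (b - x) + (b - x)²`, applied to the weight of `s`. -/
lemma blockHankel_sB_posDef (hab : a < b) (hs : (blockHankel s (N + 1)).PosDef)
    (hsHat : (blockHankel (sHat a b s) N).PosDef) : (blockHankel (sB b s) N).PosDef := by
  refine blockHankel_posDef_of_smul_eq_add (sub_pos.2 hab) (fun i => ?_) hsHat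
    (blockHankel_sA_sA_posDef hs b)
  simp only [sB, sA, sHat, Complex.ofReal_sub]
  module

lemma blockHankel_sA_posDef (hab : a < b) (hs : (blockHankel s (N + 1)).PosDef)
    (hsHat : (blockHankel (sHat a b s) N).PosDef) : (blockHankel (sA a s) N).PosDef := by
  refine blockHankel_posDef_of_smul_eq_add (sub_pos.2 hab) (fun i => ?_) hsHat
    (blockHankel_sA_sA_posDef hs a)
  simp only [sA, sHat, Complex.ofReal_sub]
  module

lemma blockHankel_posDef_of_sB_sA (hab : a < b) (hB : (blockHankel (sB b s) N).PosDef)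
    (hA : (blockHankel (sA a s) N).PosDef) : (blockHankel s N).PosDef := by
  refine blockHankel_posDef_of_smul_eq_add (sub_pos.2 hab) (fun i => ?_) hB hA
  simp only [sA, sB, Complex.ofReal_sub]
  module

lemma blockHankel_sHat_posDef (hab : a < b) (hB : (blockHankel (sB b s) (N + 1)).PosDef)
    (hA : (blockHankel (sA a s) (N + 1)).PosDef) : (blockHankel (sHat a b s) N).PosDef := by
  refine blockHankel_posDef_of_smul_eq_add (sub_pos.2 hab) (fun i => ?_)
    (blockHankel_sA_sA_posDef hB a) (blockHankel_sA_sA_posDef hA b)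
  simp only [sA, sB, sHat, Complex.ofReal_sub]
  module

namespace HausdorffPosDef

variable {m : ℕ}

lemma posDef_blockHankel_sHat (hab : a < b) (hs : HausdorffPosDef a b s m) (hN : 2 * N ≤ m) :
    (blockHankel s (N + 1)).PosDef ∧ (blockHankel (sHat a b s) N).PosDef := by
  obtain ⟨n, rfl | rfl⟩ := m.even_or_odd'
  · refine ⟨blockHankel_posDef_mono (hs.1 n rfl).1 (by omega), ?_⟩
    cases N with
    | zero => exact ⟨by ext ⟨i, _⟩; exact i.elim0, fun x hx => (hx (Subsingleton.elim _ _)).elim⟩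
    | succ N => exact blockHankel_posDef_mono ((hs.1 n rfl).2 (n - 1) (by omega)) (by omega)
  · obtain ⟨hB, hA⟩ := hs.2 n rfl
    have hB' := blockHankel_posDef_mono (f := sB b s) hB (show N + 1 ≤ n + 1 by omega)
    have hA' := blockHankel_posDef_mono (f := sA a s) hA (show N + 1 ≤ n + 1 by omega)
    exact ⟨blockHankel_posDef_of_sB_sA hab hB' hA', blockHankel_sHat_posDef hab hB' hA'⟩

lemma posDef_blockHankel_sB_sA (hab : a < b) (hs : HausdorffPosDef a b s m)
    (hN : 2 * N ≤ m + 1) :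
    (blockHankel (sB b s) N).PosDef ∧ (blockHankel (sA a s) N).PosDef := by
  obtain ⟨n, rfl | rfl⟩ := m.even_or_odd'
  · obtain ⟨h, hHat⟩ := hs.posDef_blockHankel_sHat hab (show 2 * N ≤ 2 * n by omega)
    exact ⟨blockHankel_sB_posDef hab h hHat, blockHankel_sA_posDef hab h hHat⟩
  · exact ⟨blockHankel_posDef_mono (hs.2 n rfl).1 (by omega),
      blockHankel_posDef_mono (hs.2 n rfl).2 (by omega)⟩

lemma isHermitian (hab : a < b) (hs : HausdorffPosDef a b s m) {i : ℕ} (hi : i ≤ m) :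
    (s i).IsHermitian := by
  obtain ⟨n, rfl | rfl⟩ := i.even_or_odd'
  · exact isHermitian_of_blockHankel (hs.posDef_blockHankel_sHat hab hi).1.isHermitian (by omega)
  · have hs' : (s (2 * n)).IsHermitian := isHermitian_of_blockHankel
      (hs.posDef_blockHankel_sHat hab (show 2 * n ≤ m by omega)).1.isHermitian (by omega)
    have hA : (sA a s (2 * n)).IsHermitian := isHermitian_of_blockHankel
      (hs.posDef_blockHankel_sB_sA hab (show 2 * (n + 1) ≤ m + 1 by omega)).2.isHermitian
      (by omega)
    simpa [sA] using hA.add (hs'.smul (k := (a : ℂ)) (Complex.conj_ofReal a))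

end HausdorffPosDef

end Positivity

section Resolvent

variable {q j : ℕ} {n : Type*}

lemma T_mul_apply_zero (M : Matrix (Fin (j + 1) × Fin q) n ℂ) (r : Fin q) (c : n) :
    (T q j * M) (0, r) c = 0 := by
  simp [Matrix.mul_apply, T]

lemma T_mul_apply_succ (M : Matrix (Fin (j + 1) × Fin q) n ℂ) (i : Fin j) (r : Fin q) (c : n) :
    (T q j * M) (i.succ, r) c = M (i.castSucc, r) c := by
  rw [Matrix.mul_apply, Finset.sum_eq_single (i.castSucc, r)]
  · simp [T]
  · rintro ⟨k, t⟩ - h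
    have hne : ¬ ((i : ℕ) = k ∧ r = t) := fun ⟨hik, hrt⟩ => h (by ext <;> simp [hik, hrt])
    simp [T, hne]
  · simp

lemma T_pow_apply_eq_zero (k : ℕ) (i : Fin (j + 1)) (hi : (i : ℕ) < k) (r : Fin q)
    (y : Fin (j + 1) × Fin q) : (T q j ^ k) (i, r) y = 0 := by
  induction k generalizing i with
  | zero => omega
  | succ k ih =>
    rw [pow_succ']
    cases i using Fin.cases with
    | zero => exact T_mul_apply_zero _ _ _
    | succ i =>
      rw [T_mul_apply_succ]
      exact ih _ (Nat.lt_of_succ_lt_succ hi)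

lemma isNilpotent_T (q j : ℕ) : IsNilpotent (T q j) :=
  ⟨j + 1, Matrix.ext fun x y => T_pow_apply_eq_zero (j + 1) x.1 x.1.2 x.2 y⟩

lemma R_mul_blockCol {d e : ℕ → Matrix (Fin q) (Fin q) ℂ} {z : ℂ} (h_zero : d 0 = e 0)
    (h_succ : ∀ i, d (i + 1) = e (i + 1) - z • e i) :
    R q j z * blockCol d (j + 1) = blockCol e (j + 1) := by
  have hunit : IsUnit (1 - z • T q j).det :=
    (Matrix.isUnit_iff_isUnit_det _).1 ((isNilpotent_T q j).smul z).isUnit_one_sub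
  have hd : blockCol d (j + 1) = (1 - z • T q j) * blockCol e (j + 1) := by
    rw [Matrix.sub_mul, Matrix.one_mul, Matrix.smul_mul]
    ext ⟨i, r⟩ c
    rw [Matrix.sub_apply, Matrix.smul_apply]
    cases i using Fin.cases with
    | zero => simp [T_mul_apply_zero, blockCol, h_zero]
    | succ i => simp [T_mul_apply_succ, blockCol, h_succ]
  rw [hd, R, Matrix.nonsing_inv_mul_cancel_left _ _ hunit]

lemma R_mul_v (z : ℂ) :
    R q j z * v q j = blockCol (fun i => algebraMap ℂ (Matrix (Fin q) (Fin q) ℂ) z ^ i) (j + 1) :=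
  R_mul_blockCol (by simp) fun i => by simp [Algebra.smul_def, pow_succ']

lemma R_mul_ut2 (a : ℝ) (f : ℕ → Matrix (Fin q) (Fin q) ℂ) :
    R q j a * ut2 a f j = -blockCol f (j + 1) :=
  R_mul_blockCol (e := -f) (by simp) fun i => by simp

lemma u2_add_eq_ut2 (a b : ℝ) (s : ℕ → Matrix (Fin q) (Fin q) ℂ) :
    u2 a b s j + (a : ℂ) • (v q j * s 0) = ut2 a (sB b s) j := by
  have hv : v q j * s 0 = blockCol (fun i => if i = 0 then s 0 else 0) (j + 1) := by
    ext ⟨i, r⟩ c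
    by_cases hi : i = 0 <;> simp [Matrix.mul_apply, v, blockCol, hi, Matrix.one_apply]
  rw [hv]
  ext ⟨i, r⟩ c
  cases i using Fin.cases with
  | zero =>
    simp only [u2, blockCol, Fin.val_eq_zero_iff, neg_add_rev, Matrix.smul_of, Complex.coe_smul,
      Matrix.add_apply, Matrix.of_apply, ↓reduceIte, Matrix.smul_apply, smul_eq_mul, Pi.smul_apply,
      Complex.real_smul, ut2, sB, zero_add, neg_sub, Matrix.sub_apply]
    ring
  | succ i =>
    simp only [u2, blockCol, Fin.val_eq_zero_iff, neg_add_rev, sHat, neg_smul, neg_sub,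
      Matrix.smul_of, Complex.coe_smul, Matrix.add_apply, Matrix.of_apply, Fin.succ_ne_zero,
      ↓reduceIte, Fin.val_succ, add_tsub_cancel_right, Matrix.sub_apply, Matrix.neg_apply,
      Matrix.smul_apply, smul_eq_mul, Pi.smul_apply, Matrix.zero_apply, smul_zero, add_zero, ut2,
      sB, zero_add, Complex.real_smul]
    ring

end Resolvent

section Identification

variable {q j : ℕ} {a b : ℝ} {s : ℕ → Matrix (Fin q) (Fin q) ℂ}

lemma hatH1_eq_schur (s : ℕ → Matrix (Fin q) (Fin q) ℂ) : hatH1 s = schur s :=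
  funext (Nat.rec (schur_zero _).symm fun _ _ => rfl)

lemma hatH2_eq_schur (a b : ℝ) (s : ℕ → Matrix (Fin q) (Fin q) ℂ) :
    hatH2 a b s = schur (sHat a b s) :=
  funext (Nat.rec (schur_zero _).symm fun _ _ => rfl)

lemma hatK1_eq_schur (b : ℝ) (s : ℕ → Matrix (Fin q) (Fin q) ℂ) :
    hatK1 b s = schur (sB b s) :=
  funext (Nat.rec (schur_zero _).symm fun _ _ => rfl)

lemma hatK2_eq_schur (a : ℝ) (s : ℕ → Matrix (Fin q) (Fin q) ℂ) :
    hatK2 a s = schur (sA a s) :=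
  funext (Nat.rec (schur_zero _).symm fun _ _ => rfl)

lemma rowI_mul_blockCol (B : Matrix (Fin q) (Fin j × Fin q) ℂ)
    (e : ℕ → Matrix (Fin q) (Fin q) ℂ) :
    rowI B * blockCol e (j + 1) = B * blockCol e j + e j := by
  ext r c
  simp [rowI, blockCol, Matrix.mul_apply, Fintype.sum_prod_type, Fin.sum_univ_castSucc,
    Matrix.one_apply]

lemma rowI_mul_R_mul_v (f : ℕ → Matrix (Fin q) (Fin q) ℂ) (z : ℂ) :
    rowI (orthRow f j) * R q j z * v q j =
      (orthPoly f j).eval (algebraMap ℂ (Matrix (Fin q) (Fin q) ℂ) z) := by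
  rw [Matrix.mul_assoc, R_mul_v, rowI_mul_blockCol, ← momentFunctional_orthPoly,
    momentFunctional_pow]

lemma rowI_mul_R_mul_ut2 (f e : ℕ → Matrix (Fin q) (Fin q) ℂ) (a : ℝ) :
    rowI (orthRow f j) * R q j a * ut2 a e j = -momentFunctional e (orthPoly f j) := by
  rw [Matrix.mul_assoc, R_mul_ut2, Matrix.mul_neg, rowI_mul_blockCol, momentFunctional_orthPoly]

lemma P1_eq_eval (s : ℕ → Matrix (Fin q) (Fin q) ℂ) (j : ℕ) (z : ℂ) :
    P1 s j z = (orthPoly s j).eval (algebraMap ℂ (Matrix (Fin q) (Fin q) ℂ) z) := by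
  cases j with
  | zero => rw [orthPoly_zero, eval_one, P1]
  | succ j => exact rowI_mul_R_mul_v s z

lemma Gamma1_eq_eval (b : ℝ) (s : ℕ → Matrix (Fin q) (Fin q) ℂ) (j : ℕ) (z : ℂ) :
    Gamma1 b s j z =
      (orthPoly (sB b s) j).eval (algebraMap ℂ (Matrix (Fin q) (Fin q) ℂ) z) := by
  cases j with
  | zero => rw [orthPoly_zero, eval_one, Gamma1]
  | succ j => exact rowI_mul_R_mul_v (sB b s) z

lemma Theta2_eq_momentFunctional (a : ℝ) (s : ℕ → Matrix (Fin q) (Fin q) ℂ) (j : ℕ) :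
    Theta2 a s j a = -momentFunctional s (orthPoly (sA a s) j) := by
  cases j with
  | zero => rw [orthPoly_zero, ← pow_zero X, momentFunctional_X_pow, Theta2]
  | succ j => exact rowI_mul_R_mul_ut2 (sA a s) s a

lemma Q2_eq_momentFunctional (a b : ℝ) (s : ℕ → Matrix (Fin q) (Fin q) ℂ) (j : ℕ) :
    Q2 a b s j a = momentFunctional (sB b s) (orthPoly (sHat a b s) j) := by
  cases j with
  | zero =>
    rw [orthPoly_zero, ← pow_zero X, momentFunctional_X_pow, Q2, sB]
    module
  | succ j =>
    rw [Q2, u2_add_eq_ut2]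
    exact neg_eq_iff_eq_neg.2 (rowI_mul_R_mul_ut2 (sHat a b s) (sB b s) a)

lemma dsmT_eq_hankelInvForm (a b : ℝ) (s : ℕ → Matrix (Fin q) (Fin q) ℂ) (j : ℕ) :
    dsmT a b s j = hankelInvForm (sB b s)
      (fun i => algebraMap ℂ (Matrix (Fin q) (Fin q) ℂ) a ^ i) (j + 1) := by
  rw [hankelInvForm, ← R_mul_v, Matrix.conjTranspose_mul, ← Matrix.mul_assoc]
  rfl

lemma dsmG_eq_hankelInvForm (a b : ℝ) (hs : (s 0).IsHermitian) (j : ℕ) :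
    dsmG a b s j = hankelInvForm (sHat a b s) (sB b s) (j + 1) := by
  have hstar : (u2 a b s j)ᴴ + (a : ℂ) • (s 0 * (v q j)ᴴ) = (ut2 a (sB b s) j)ᴴ := by
    rw [← u2_add_eq_ut2, Matrix.conjTranspose_add, Matrix.conjTranspose_smul,
      Matrix.conjTranspose_mul, hs.eq, RCLike.star_def, Complex.conj_ofReal]
  have hcol : blockCol (sB b s) (j + 1) = -(R q j a * ut2 a (sB b s) j) := by
    rw [R_mul_ut2, neg_neg]
  rw [dsmG, hstar, u2_add_eq_ut2, hankelInvForm, hcol, Matrix.conjTranspose_neg,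
    Matrix.conjTranspose_mul]
  simp only [Matrix.neg_mul, Matrix.mul_neg, neg_neg, Matrix.mul_assoc]
  rfl

lemma dsmM_eq_Gamma1 (hK : (K1 b s j).PosDef) :
    dsmM a b s j = (Gamma1 b s j a)ᴴ * (hatK1 b s j)⁻¹ * Gamma1 b s j a := by
  have hform := hankelInvForm_succ hK
    fun i => algebraMap ℂ (Matrix (Fin q) (Fin q) ℂ) a ^ i
  rw [Gamma1_eq_eval, ← momentFunctional_pow, hatK1_eq_schur]
  cases j with
  | zero => rw [dsmM, dsmT_eq_hankelInvForm, hform, hankelInvForm_zero, zero_add]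
  | succ j => rw [dsmM, dsmT_eq_hankelInvForm, dsmT_eq_hankelInvForm, hform, add_sub_cancel_left]

lemma dsmL_eq_Q2 (hs : (s 0).IsHermitian) (hH : (H2 a b s j).PosDef) :
    dsmL a b s j = (Q2 a b s j a)ᴴ * (hatH2 a b s j)⁻¹ * Q2 a b s j a := by
  have hform := hankelInvForm_succ hH (sB b s)
  rw [Q2_eq_momentFunctional, hatH2_eq_schur]
  cases j with
  | zero => rw [dsmL, dsmG_eq_hankelInvForm a b hs, hform, hankelInvForm_zero, zero_add]
  | succ j =>
    rw [dsmL, dsmG_eq_hankelInvForm a b hs, dsmG_eq_hankelInvForm a b hs, hform,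
      add_sub_cancel_left]

end Identification

section Telescoping

variable {q : ℕ}

lemma prodRight_conjTranspose (A : ℕ → Matrix (Fin q) (Fin q) ℂ) (N : ℕ) :
    prodRight (fun k => (A k)ᴴ) N = (prodLeft A N)ᴴ := by
  induction N with
  | zero => rw [prodRight_zero, prodLeft_zero, Matrix.conjTranspose_one]
  | succ N ih => rw [prodRight_succ, prodLeft_succ, Matrix.conjTranspose_mul, ih]

lemma inv_conjTranspose_mul_congr_mul_inv {Ψ : Matrix (Fin q) (Fin q) ℂ} (hΨ : IsUnit Ψ.det)
    (M : Matrix (Fin q) (Fin q) ℂ) : Ψ⁻¹ᴴ * (Ψᴴ * M * Ψ) * Ψ⁻¹ = M := by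
  rw [← Matrix.mul_assoc, ← Matrix.mul_assoc, ← Matrix.conjTranspose_mul,
    Matrix.mul_nonsing_inv _ hΨ, Matrix.conjTranspose_one, Matrix.one_mul,
    Matrix.mul_nonsing_inv_cancel_right _ _ hΨ]

lemma isUnit_det_prodLeft {A : ℕ → Matrix (Fin q) (Fin q) ℂ} {N : ℕ}
    (hA : ∀ k < N, IsUnit (A k).det) : IsUnit (prodLeft A N).det := by
  induction N with
  | zero => exact isUnit_iff_ne_zero.2 (by simp [prodLeft_zero])
  | succ N ih =>
    rw [prodLeft_succ, Matrix.det_mul]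
    exact (hA N N.lt_succ_self).mul (ih fun k hk => hA k (hk.trans N.lt_succ_self))

lemma prodLeft_inv_of_telescoping {A Ψ : ℕ → Matrix (Fin q) (Fin q) ℂ} {N : ℕ} (h0 : Ψ 0 = 1)
    (hΨ : ∀ k < N, IsUnit (Ψ k).det) (hA : ∀ k < N, A k = (Ψ k)⁻¹ * Ψ (k + 1)) :
    prodLeft (fun k => (A k)⁻¹) N = (Ψ N)⁻¹ := by
  induction N with
  | zero => rw [prodLeft_zero, h0, inv_one]
  | succ N ih =>
    have hN := hΨ N N.lt_succ_self
    rw [prodLeft_succ, ih (fun k hk => hΨ k (hk.trans N.lt_succ_self))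
      (fun k hk => hA k (hk.trans N.lt_succ_self)), hA N N.lt_succ_self, Matrix.mul_inv_rev,
      Matrix.nonsing_inv_nonsing_inv _ hN, Matrix.mul_nonsing_inv_cancel_right _ _ hN]

variable {h κ : ℕ → Matrix (Fin q) (Fin q) ℂ} {N : ℕ}

lemma isUnit_det_prodLeft_inv_mul (hh : ∀ k < N, (h k).PosDef) (hκ : ∀ k < N, (κ k).PosDef) :
    IsUnit (prodLeft (fun k => (h k)⁻¹ * κ k) N).det :=
  isUnit_det_prodLeft fun k hk => by
    rw [Matrix.det_mul]
    exact (hh k hk).inv.det_pos.ne'.isUnit.mul (hκ k hk).det_pos.ne'.isUnit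

lemma prodLeft_mul_inv_eq_inv_conjTranspose (hh : ∀ k < N, (h k).PosDef)
    (hκ : ∀ k < N, (κ k).IsHermitian) :
    prodLeft (fun k => h k * (κ k)⁻¹) N = (prodLeft (fun k => (h k)⁻¹ * κ k) N)ᴴ⁻¹ := by
  induction N with
  | zero => rw [prodLeft_zero, prodLeft_zero, Matrix.conjTranspose_one, inv_one]
  | succ N ih =>
    have hN := hh N N.lt_succ_self
    rw [prodLeft_succ, prodLeft_succ, Matrix.conjTranspose_mul, Matrix.conjTranspose_mul,
      hN.isHermitian.inv.eq, (hκ N N.lt_succ_self).eq, Matrix.mul_inv_rev, Matrix.mul_inv_rev,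
      Matrix.nonsing_inv_nonsing_inv _ hN.det_pos.ne'.isUnit,
      ih (fun k hk => hh k (hk.trans N.lt_succ_self)) fun k hk => hκ k (hk.trans N.lt_succ_self)]

end Telescoping

namespace HausdorffPosDef

variable {q : ℕ} {a b : ℝ} {s : ℕ → Matrix (Fin q) (Fin q) ℂ} {m j : ℕ}

lemma H1_posDef (hab : a < b) (hs : HausdorffPosDef a b s m) (hj : 2 * j ≤ m) :
    (H1 s j).PosDef :=
  (hs.posDef_blockHankel_sHat hab hj).1

lemma H2_posDef (hab : a < b) (hs : HausdorffPosDef a b s m) (hj : 2 * j + 2 ≤ m) :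
    (H2 a b s j).PosDef :=
  (hs.posDef_blockHankel_sHat hab (N := j + 1) hj).2

lemma K1_posDef (hab : a < b) (hs : HausdorffPosDef a b s m) (hj : 2 * j + 1 ≤ m) :
    (K1 b s j).PosDef :=
  (hs.posDef_blockHankel_sB_sA hab (N := j + 1) (by omega)).1

lemma K2_posDef (hab : a < b) (hs : HausdorffPosDef a b s m) (hj : 2 * j + 1 ≤ m) :
    (K2 a s j).PosDef :=
  (hs.posDef_blockHankel_sB_sA hab (N := j + 1) (by omega)).2

lemma hatH1_posDef (hab : a < b) (hs : HausdorffPosDef a b s m) (hj : 2 * j ≤ m) :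
    (hatH1 s j).PosDef := by
  rw [hatH1_eq_schur]
  exact schur_posDef (hs.H1_posDef hab hj)

lemma hatH2_posDef (hab : a < b) (hs : HausdorffPosDef a b s m) (hj : 2 * j + 2 ≤ m) :
    (hatH2 a b s j).PosDef := by
  rw [hatH2_eq_schur]
  exact schur_posDef (hs.H2_posDef hab hj)

lemma hatK1_posDef (hab : a < b) (hs : HausdorffPosDef a b s m) (hj : 2 * j + 1 ≤ m) :
    (hatK1 b s j).PosDef := by
  rw [hatK1_eq_schur]
  exact schur_posDef (hs.K1_posDef hab hj)

lemma hatK2_posDef (hab : a < b) (hs : HausdorffPosDef a b s m) (hj : 2 * j + 1 ≤ m) :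
    (hatK2 a s j).PosDef := by
  rw [hatK2_eq_schur]
  exact schur_posDef (hs.K2_posDef hab hj)

lemma isHermitian_sB (hab : a < b) (hs : HausdorffPosDef a b s m) {i : ℕ} (hi : i + 1 ≤ m) :
    (sB b s i).IsHermitian :=
  ((hs.isHermitian hab (i.le_succ.trans hi)).smul (k := (b : ℂ)) (Complex.conj_ofReal b)).sub
    (hs.isHermitian hab hi)

lemma P1_eq (hab : a < b) (hs : HausdorffPosDef a b s m) (hj : 2 * j ≤ m + 1) :
    P1 s j a = (-1 : ℂ) ^ j • prodLeft (fun k => hatK2 a s k * (hatH1 s k)⁻¹) j := by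
  have hH : (blockHankel s j).PosDef :=
    blockHankel_posDef_mono (hs.posDef_blockHankel_sHat hab (N := m / 2) (by omega)).1 (by omega)
  rw [P1_eq_eval, hatK2_eq_schur, hatH1_eq_schur]
  exact eval_orthPoly hH (hs.posDef_blockHankel_sB_sA hab hj).2
    fun i hi => hs.isHermitian hab (by omega)

lemma Gamma1_eq (hab : a < b) (hs : HausdorffPosDef a b s m) (hj : 2 * j ≤ m) :
    Gamma1 b s j a = (-1 : ℂ) ^ j • prodLeft (fun k => hatH2 a b s k * (hatK1 b s k)⁻¹) j := by
  have hH := (hs.posDef_blockHankel_sHat hab hj).2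
  rw [Gamma1_eq_eval, hatH2_eq_schur, hatK1_eq_schur]
  rw [sHat_eq_sA_sB] at hH ⊢
  exact eval_orthPoly (hs.posDef_blockHankel_sB_sA hab (by omega)).1 hH
    fun i hi => hs.isHermitian_sB hab (by omega)

lemma Q2_eq (hab : a < b) (hs : HausdorffPosDef a b s m) (hj : 2 * j + 1 ≤ m) :
    Q2 a b s j a = (-1 : ℂ) ^ j •
      (hatK1 b s j * prodLeft (fun k => (hatH2 a b s k)⁻¹ * hatK1 b s k) j) := by
  have hH := (hs.posDef_blockHankel_sHat hab (N := j) (by omega)).2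
  rw [Q2_eq_momentFunctional, hatH2_eq_schur, hatK1_eq_schur]
  rw [sHat_eq_sA_sB] at hH ⊢
  exact momentFunctional_orthPoly_sA (hs.posDef_blockHankel_sB_sA hab (by omega)).1 hH
    fun i hi => hs.isHermitian_sB hab (by omega)

lemma Theta2_eq (hab : a < b) (hs : HausdorffPosDef a b s m) (hj : 2 * j ≤ m) :
    Theta2 a s j a = (-1 : ℂ) ^ (j + 1) •
      (hatH1 s j * prodLeft (fun k => (hatK2 a s k)⁻¹ * hatH1 s k) j) := by
  have hH := blockHankel_posDef_mono (hs.posDef_blockHankel_sHat hab hj).1 j.le_succ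
  rw [Theta2_eq_momentFunctional, hatK2_eq_schur, hatH1_eq_schur,
    momentFunctional_orthPoly_sA hH (hs.posDef_blockHankel_sB_sA hab (by omega)).2
      fun i hi => hs.isHermitian hab (by omega), pow_succ, mul_neg_one, neg_smul]

lemma isUnit_det_prodLeft_hatH2_inv_mul_hatK1 (hab : a < b) (hs : HausdorffPosDef a b s m)
    (hj : 2 * j ≤ m) : IsUnit (prodLeft (fun k => (hatH2 a b s k)⁻¹ * hatK1 b s k) j).det :=
  isUnit_det_prodLeft_inv_mul (fun k hk => hs.hatH2_posDef hab (by omega))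
    fun k hk => hs.hatK1_posDef hab (by omega)

lemma mulVec_prodLeft_hatH2_inv_mul_hatK1_injective (hab : a < b) (hs : HausdorffPosDef a b s m)
    (hj : 2 * j ≤ m) :
    Function.Injective (prodLeft (fun k => (hatH2 a b s k)⁻¹ * hatK1 b s k) j).mulVec :=
  Matrix.mulVec_injective_of_isUnit ((Matrix.isUnit_iff_isUnit_det _).2
    (hs.isUnit_det_prodLeft_hatH2_inv_mul_hatK1 hab hj))

lemma dsmM_eq_prod (hab : a < b) (hs : HausdorffPosDef a b s m) (hj : 2 * j + 1 ≤ m) :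
    dsmM a b s j = prodRight (fun k => (hatH2 a b s k * (hatK1 b s k)⁻¹)ᴴ) j *
      (hatK1 b s j)⁻¹ * prodLeft (fun k => hatH2 a b s k * (hatK1 b s k)⁻¹) j := by
  rw [prodRight_conjTranspose, dsmM_eq_Gamma1 (hs.K1_posDef hab hj), hs.Gamma1_eq hab (by omega)]
  simp [Matrix.conjTranspose_smul, smul_smul, ← mul_pow]

lemma dsmL_eq_prod (hab : a < b) (hs : HausdorffPosDef a b s m) (hj : 2 * j + 2 ≤ m) :
    dsmL a b s j = prodRight (fun k => ((hatH2 a b s k)⁻¹ * hatK1 b s k)ᴴ) (j + 1) *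
      hatH2 a b s j * prodLeft (fun k => (hatH2 a b s k)⁻¹ * hatK1 b s k) (j + 1) := by
  have hh := hs.hatH2_posDef hab hj
  rw [prodRight_conjTranspose, dsmL_eq_Q2 (hs.isHermitian hab m.zero_le) (hs.H2_posDef hab hj),
    hs.Q2_eq hab (by omega), prodLeft_succ, Matrix.mul_assoc (hatH2 a b s j)⁻¹,
    Matrix.conjTranspose_mul (hatH2 a b s j)⁻¹, hh.isHermitian.inv.eq,
    Matrix.nonsing_inv_mul_cancel_right _ _ hh.det_pos.ne'.isUnit]
  simp [Matrix.conjTranspose_smul, smul_smul, ← mul_pow, Matrix.mul_assoc]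

lemma dsmM_eq_inv (hab : a < b) (hs : HausdorffPosDef a b s m) (hj : 2 * j + 1 ≤ m) :
    dsmM a b s j = ((prodLeft (fun k => (hatH2 a b s k)⁻¹ * hatK1 b s k) j)ᴴ * hatK1 b s j *
      prodLeft (fun k => (hatH2 a b s k)⁻¹ * hatK1 b s k) j)⁻¹ := by
  rw [hs.dsmM_eq_prod hab hj, prodRight_conjTranspose, prodLeft_mul_inv_eq_inv_conjTranspose
    (fun k hk => hs.hatH2_posDef hab (by omega))
    fun k hk => (hs.hatK1_posDef hab (by omega)).isHermitian, Matrix.conjTranspose_nonsing_inv,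
    Matrix.conjTranspose_conjTranspose, Matrix.mul_inv_rev, Matrix.mul_inv_rev, Matrix.mul_assoc]

lemma dsmM_inv_posDef (hab : a < b) (hs : HausdorffPosDef a b s m) (hj : 2 * j + 1 ≤ m) :
    ((prodLeft (fun k => (hatH2 a b s k)⁻¹ * hatK1 b s k) j)ᴴ * hatK1 b s j *
      prodLeft (fun k => (hatH2 a b s k)⁻¹ * hatK1 b s k) j).PosDef :=
  (hs.hatK1_posDef hab hj).conjTranspose_mul_mul_same
    (hs.mulVec_prodLeft_hatH2_inv_mul_hatK1_injective hab (by omega))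

lemma dsmM_posDef (hab : a < b) (hs : HausdorffPosDef a b s m) (hj : 2 * j + 1 ≤ m) :
    (dsmM a b s j).PosDef := by
  rw [hs.dsmM_eq_inv hab hj]
  exact (hs.dsmM_inv_posDef hab hj).inv

lemma dsmL_posDef (hab : a < b) (hs : HausdorffPosDef a b s m) (hj : 2 * j + 2 ≤ m) :
    (dsmL a b s j).PosDef := by
  rw [hs.dsmL_eq_prod hab hj, prodRight_conjTranspose]
  exact (hs.hatH2_posDef hab hj).conjTranspose_mul_mul_same
    (hs.mulVec_prodLeft_hatH2_inv_mul_hatK1_injective hab (by omega))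

lemma dsmM_mul_dsmL (hab : a < b) (hs : HausdorffPosDef a b s m) (hj : 2 * j + 2 ≤ m) :
    dsmM a b s j * dsmL a b s j =
      (prodLeft (fun k => (hatH2 a b s k)⁻¹ * hatK1 b s k) j)⁻¹ *
        prodLeft (fun k => (hatH2 a b s k)⁻¹ * hatK1 b s k) (j + 1) := by
  have hh := hs.hatH2_posDef hab hj
  have hκ := hs.hatK1_posDef hab (j := j) (by omega)
  have hΨ := hs.isUnit_det_prodLeft_hatH2_inv_mul_hatK1 hab (j := j) (by omega)
  have hsucc : (prodLeft (fun k => (hatH2 a b s k)⁻¹ * hatK1 b s k) (j + 1))ᴴ * hatH2 a b s j =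
      (prodLeft (fun k => (hatH2 a b s k)⁻¹ * hatK1 b s k) j)ᴴ * hatK1 b s j := by
    rw [prodLeft_succ, Matrix.conjTranspose_mul, Matrix.conjTranspose_mul, hκ.isHermitian.eq,
      hh.isHermitian.inv.eq, ← Matrix.mul_assoc,
      Matrix.nonsing_inv_mul_cancel_right _ _ hh.det_pos.ne'.isUnit]
  have hunit : IsUnit ((prodLeft (fun k => (hatH2 a b s k)⁻¹ * hatK1 b s k) j)ᴴ *
      hatK1 b s j).det := by
    rw [Matrix.det_mul, Matrix.det_conjTranspose]
    exact hΨ.star.mul hκ.det_pos.ne'.isUnit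
  rw [hs.dsmM_eq_inv hab (by omega), hs.dsmL_eq_prod hab hj, prodRight_conjTranspose, hsucc,
    Matrix.mul_inv_rev, Matrix.mul_assoc, Matrix.nonsing_inv_mul_cancel_left _ _ hunit]

lemma prodLeft_dsmM_mul_dsmL_inv (hab : a < b) (hs : HausdorffPosDef a b s m) (hj : 2 * j ≤ m) :
    prodLeft (fun k => (dsmM a b s k * dsmL a b s k)⁻¹) j =
      (prodLeft (fun k => (hatH2 a b s k)⁻¹ * hatK1 b s k) j)⁻¹ :=
  prodLeft_inv_of_telescoping (prodLeft_zero _)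
    (fun k hk => hs.isUnit_det_prodLeft_hatH2_inv_mul_hatK1 hab (by omega))
    fun k hk => hs.dsmM_mul_dsmL hab (by omega)

lemma hatH2_eq_prod (hab : a < b) (hs : HausdorffPosDef a b s m) (hj : 2 * j + 2 ≤ m) :
    hatH2 a b s j =
      prodRight (fun k => ((dsmM a b s k * dsmL a b s k)⁻¹)ᴴ) (j + 1) * dsmL a b s j *
        prodLeft (fun k => (dsmM a b s k * dsmL a b s k)⁻¹) (j + 1) := by
  rw [prodRight_conjTranspose, hs.prodLeft_dsmM_mul_dsmL_inv hab (by omega),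
    hs.dsmL_eq_prod hab hj, prodRight_conjTranspose, inv_conjTranspose_mul_congr_mul_inv
      (hs.isUnit_det_prodLeft_hatH2_inv_mul_hatK1 hab (by omega))]

lemma hatK1_eq_prod (hab : a < b) (hs : HausdorffPosDef a b s m) (hj : 2 * j + 1 ≤ m) :
    hatK1 b s j =
      prodRight (fun k => ((dsmM a b s k * dsmL a b s k)⁻¹)ᴴ) j * (dsmM a b s j)⁻¹ *
        prodLeft (fun k => (dsmM a b s k * dsmL a b s k)⁻¹) j := by
  rw [prodRight_conjTranspose, hs.prodLeft_dsmM_mul_dsmL_inv hab (by omega),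
    hs.dsmM_eq_inv hab hj,
    Matrix.nonsing_inv_nonsing_inv _ (hs.dsmM_inv_posDef hab hj).det_pos.ne'.isUnit,
    inv_conjTranspose_mul_congr_mul_inv
      (hs.isUnit_det_prodLeft_hatH2_inv_mul_hatK1 hab (by omega))]

end HausdorffPosDef

end

end THMM

theorem mainTheorem7 (q : ℕ) (a b : ℝ) (hab : a < b) (m : ℕ)
    (s : ℕ → Matrix (Fin q) (Fin q) ℂ) (hs : THMM.HausdorffPosDef a b s m) :
    -- every matrix that is inverted in the definitions or in the identities is positive definite
    (∀ j : ℕ, 2 * j ≤ m → (THMM.H1 s j).PosDef ∧ (THMM.hatH1 s j).PosDef) ∧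
    (∀ j : ℕ, 2 * j + 1 ≤ m →
      (THMM.K1 b s j).PosDef ∧ (THMM.K2 a s j).PosDef ∧
      (THMM.hatK1 b s j).PosDef ∧ (THMM.hatK2 a s j).PosDef ∧ (THMM.dsmM a b s j).PosDef) ∧
    (∀ j : ℕ, 2 * j + 2 ≤ m →
      (THMM.H2 a b s j).PosDef ∧ (THMM.hatH2 a b s j).PosDef ∧ (THMM.dsmL a b s j).PosDef) ∧
    -- the Schur complements in terms of the parameters
    (2 ≤ m → THMM.hatH2 a b s 0 =
      ((THMM.dsmM a b s 0 * THMM.dsmL a b s 0)⁻¹)ᴴ * THMM.dsmL a b s 0 *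
        (THMM.dsmM a b s 0 * THMM.dsmL a b s 0)⁻¹) ∧
    (1 ≤ m → THMM.hatK1 b s 0 = (THMM.dsmM a b s 0)⁻¹) ∧
    (∀ j : ℕ, 2 * j + 2 ≤ m → THMM.hatH2 a b s j =
      THMM.prodRight (fun k => ((THMM.dsmM a b s k * THMM.dsmL a b s k)⁻¹)ᴴ) (j + 1) *
        THMM.dsmL a b s j *
        THMM.prodLeft (fun k => (THMM.dsmM a b s k * THMM.dsmL a b s k)⁻¹) (j + 1)) ∧
    (∀ j : ℕ, 2 * j + 1 ≤ m → THMM.hatK1 b s j =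
      THMM.prodRight (fun k => ((THMM.dsmM a b s k * THMM.dsmL a b s k)⁻¹)ᴴ) j *
        (THMM.dsmM a b s j)⁻¹ *
        THMM.prodLeft (fun k => (THMM.dsmM a b s k * THMM.dsmL a b s k)⁻¹) j) ∧
    -- the values of the polynomials at `a` as alternating products of Schur complements
    (∀ j : ℕ, 2 * j ≤ m + 1 → THMM.P1 s j a =
      (-1 : ℂ) ^ j • THMM.prodLeft (fun k => THMM.hatK2 a s k * (THMM.hatH1 s k)⁻¹) j) ∧
    (∀ j : ℕ, 2 * j ≤ m → THMM.Gamma1 b s j a =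
      (-1 : ℂ) ^ j • THMM.prodLeft (fun k => THMM.hatH2 a b s k * (THMM.hatK1 b s k)⁻¹) j) ∧
    (∀ j : ℕ, 2 * j + 1 ≤ m → THMM.Q2 a b s j a =
      (-1 : ℂ) ^ j • (THMM.hatK1 b s j *
        THMM.prodLeft (fun k => (THMM.hatH2 a b s k)⁻¹ * THMM.hatK1 b s k) j)) ∧
    (∀ j : ℕ, 2 * j ≤ m → THMM.Theta2 a s j a =
      (-1 : ℂ) ^ (j + 1) • (THMM.hatH1 s j *
        THMM.prodLeft (fun k => (THMM.hatK2 a s k)⁻¹ * THMM.hatH1 s k) j)) ∧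
    -- the parameters in terms of the Schur complements
    (1 ≤ m → THMM.dsmM a b s 0 = (THMM.hatK1 b s 0)⁻¹) ∧
    (2 ≤ m → THMM.dsmL a b s 0 =
      ((THMM.hatH2 a b s 0)⁻¹ * THMM.hatK1 b s 0)ᴴ * THMM.hatH2 a b s 0 *
        ((THMM.hatH2 a b s 0)⁻¹ * THMM.hatK1 b s 0)) ∧
    (∀ j : ℕ, 2 * j + 1 ≤ m → THMM.dsmM a b s j =
      THMM.prodRight (fun k => (THMM.hatH2 a b s k * (THMM.hatK1 b s k)⁻¹)ᴴ) j *
        (THMM.hatK1 b s j)⁻¹ *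
        THMM.prodLeft (fun k => THMM.hatH2 a b s k * (THMM.hatK1 b s k)⁻¹) j) ∧
    (∀ j : ℕ, 2 * j + 2 ≤ m → THMM.dsmL a b s j =
      THMM.prodRight (fun k => ((THMM.hatH2 a b s k)⁻¹ * THMM.hatK1 b s k)ᴴ) (j + 1) *
        THMM.hatH2 a b s j *
        THMM.prodLeft (fun k => (THMM.hatH2 a b s k)⁻¹ * THMM.hatK1 b s k) (j + 1)) := by
  exact ⟨fun j hj => ⟨hs.H1_posDef hab hj, hs.hatH1_posDef hab hj⟩,
    fun j hj => ⟨hs.K1_posDef hab hj, hs.K2_posDef hab hj, hs.hatK1_posDef hab hj,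
      hs.hatK2_posDef hab hj, hs.dsmM_posDef hab hj⟩,
    fun j hj => ⟨hs.H2_posDef hab hj, hs.hatH2_posDef hab hj, hs.dsmL_posDef hab hj⟩,
    fun hm => by simpa [THMM.prodRight, THMM.prodLeft] using hs.hatH2_eq_prod hab (j := 0) hm,
    fun hm => by simpa [THMM.prodRight, THMM.prodLeft] using hs.hatK1_eq_prod hab (j := 0) hm,
    fun j hj => hs.hatH2_eq_prod hab hj, fun j hj => hs.hatK1_eq_prod hab hj,
    fun j hj => hs.P1_eq hab hj, fun j hj => hs.Gamma1_eq hab hj, fun j hj => hs.Q2_eq hab hj,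
    fun j hj => hs.Theta2_eq hab hj,
    fun hm => by simpa [THMM.prodRight, THMM.prodLeft] using hs.dsmM_eq_prod hab (j := 0) hm,
    fun hm => by simpa [THMM.prodRight, THMM.prodLeft] using hs.dsmL_eq_prod hab (j := 0) hm,
    fun j hj => hs.dsmM_eq_prod hab hj, fun j hj => hs.dsmL_eq_prod hab hj⟩
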